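/- Let $\mathcal H^{A_1},\dots,\mathcal H^{A_n},\mathcal H^{B_1},\dots,\mathcal H^{B_m}$ be nonzero finite-dimensional complex Hilbert spaces and let $\{\{\mathcal F_{c|z}\}_c\}_z$ be a multipartite multi-instrument: for each setting $z$ (from a nonempty set) and outcome $c$ (from a finite set), $\mathcal F_{c|z}:\mathcal L(\bigotimes_{i=1}^n\mathcal H^{A_i})\to\mathcal L(\bigotimes_{j=1}^m\mathcal H^{B_j})$ is a completely positive linear map, and $\sum_c\mathcal F_{c|z}$ is trace-preserving for every $z$. **Classicality.** Call the multi-instrument *classical* if the statistics of all the circuits $\mathrm{Tr}[(\bigotimes_j M^{B_j})\,\mathcal F_{c|z}(\bigotimes_i\rho^{A_i})]$, where $\rho^{A_i}$ ranges over all density operators and $M^{B_j}$ over all effects ($0\le M^{B_j}\le\mathbb 1$), have one linear and diagram-preserving ontological representation. That is, there are finite sets $\Lambda_{A_i},\Lambda_{B_j}$, probability distributions $p(\lambda_{A_i}|\rho^{A_i})$, response functions $p(M^{B_j}|\lambda_{B_j})\ge0$ that sum to $1$ over every POVM, and conditional probability distributions $p(c\,\lambda_{\vec B}|z\,\lambda_{\vec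 A})$ with $$\mathrm{Tr}\Big[\Big(\bigotimes_j M^{B_j}\Big)\mathcal F_{c|z}\Big(\bigotimes_i\rho^{A_i}\Big)\Big]=\sum_{\lambda_{\vec A},\lambda_{\vec B}}p(c\,\lambda_{\vec B}|z\,\lambda_{\vec A})\prod_jp(M^{B_j}|\lambda_{B_j})\prod_ip(\lambda_{A_i}|\rho^{A_i}),$$ such that every finite real linear relation among states on one $A_i$, among effects on one $B_j$, or among composite processes with the same open inputs and open outputs, also holds for their representations. Here the composite processes are the finite parallel compositions, with disjoint sets of open systems, of effective processes obtained from some $\mathcal F_{c|z}$ by feeding states into some of its inputs and applying effects to some of its outputs (leaving the other systems open). An effective process is represented by the matrix obtained from $p(c\,\lambda_{\vec B}|z\,\lambda_{\vec A})$ by multiplying with the representations of these states and effects and summing over the ontic states of the closed systems; a parallel composition is represented by the product. **Operator spaces.** Let $V_{B_j}$ be the real span of all operators $\mathrm{Tr}_{B_{j'},\,j'\ne j}[(\mathbb 1^{B_j}\otimes\bigotimes_{j'\ne j}M^{B_{j'}})\,\mathcal F_{c|z}(\bigotimes_i\rho^{A_i})]$, and $V_{A_i}$ the real span of all operators $\mathrm{Tr}_{A_{i'},\,i'\ne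 i}[(\mathbb 1^{A_i}\otimes\bigotimes_{i'\ne i}\rho^{A_{i'}})\,\mathcal F_{c|z}^\dagger(\bigotimes_jM^{B_j})]$, over all $c$, $z$, density operators $\rho$ and effects $M$; let $\mathcal P_V$ be the Hilbert–Schmidt orthogonal projection onto $V$. Finite families $\{E_\lambda\}$, $\{D_\lambda\}$ of Hermitian operators form a *frame and dual frame on* $V$ if $X=\sum_\lambda\mathrm{Tr}[XD_\lambda]E_\lambda=\sum_\lambda\mathrm{Tr}[XE_\lambda]D_\lambda$ for all $X\in V$. **Theorem.** The multi-instrument is classical if and only if it admits a product frame representation, that is, if and only if there are, for each $j$, a frame of density operators $\{\sigma^{B_j}_{\lambda_{B_j}}\}$ on $V_{B_j}$ with a dual frame of Hermitian operators $\{H^{B_j}_{\lambda_{B_j}}\}$ satisfying $\sum_{\lambda_{B_j}}H^{B_j}_{\lambda_{B_j}}=\mathcal P_{V_{B_j}}(\mathbb 1)$, and, for each $i$, a frame of Hermitian operators $\{F^{A_i}_{\lambda_{A_i}}\}$ on $V_{A_i}$ with $\mathrm{Tr}[F^{A_i}_{\lambda_{A_i}}]=1$, whose dual frame is a POVM $\{G^{A_i}_{\lambda_{A_i}}\}$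 with $\sum_{\lambda_{A_i}}G^{A_i}_{\lambda_{A_i}}=\mathcal P_{V_{A_i}}(\mathbb 1)=\mathbb 1$, such that for all $c,z$ $$\mathcal F_{c|z}(\cdot)=\sum_{\lambda_{\vec A},\lambda_{\vec B}}\Big(\bigotimes_j\sigma^{B_j}_{\lambda_{B_j}}\Big)\,\mathrm{Tr}\Big[\Big(\bigotimes_jH^{B_j}_{\lambda_{B_j}}\Big)\mathcal F_{c|z}\Big(\bigotimes_iF^{A_i}_{\lambda_{A_i}}\Big)\Big]\,\mathrm{Tr}\Big[\Big(\bigotimes_iG^{A_i}_{\lambda_{A_i}}\Big)(\cdot)\Big]$$ and $$\mathrm{Tr}\Big[\Big(\bigotimes_jH^{B_j}_{\lambda_{B_j}}\Big)\mathcal F_{c|z}\Big(\bigotimes_iF^{A_i}_{\lambda_{A_i}}\Big)\Big]\ge0\qquad\text{for all }\lambda_{\vec A},\lambda_{\vec B},c,z.$$ -/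

import Mathlib

open scoped ComplexOrder BigOperators

noncomputable section

namespace QProc

/-! ### Operators on tensor products of finite-dimensional Hilbert spaces

A family of systems is `d : ι → ℕ`; the `i`-th Hilbert space is `ℂ^(d i)` with a fixed orthonormal
basis, and operators are matrices. An operator on `⨂_{i ∈ S} ℂ^(d i)` is a matrix whose rows and
columns are indexed by `∀ i : S, Fin (d i)`. -/

section Operators

variable {ι : Type*} [Fintype ι] [DecidableEq ι]

/-- Operators on the full tensor product `⨂_i ℂ^(d i)`. -/
abbrev Op (d : ι → ℕ) : Type _ := Matrix (∀ i, Fin (d i)) (∀ i, Fin (d i)) ℂ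

/-- Operators on the tensor product `⨂_{i ∈ S} ℂ^(d i)` over a subset `S` of the systems. -/
abbrev OpOn (d : ι → ℕ) (S : Finset ι) : Type _ :=
  Matrix (∀ i : {i // i ∈ S}, Fin (d i)) (∀ i : {i // i ∈ S}, Fin (d i)) ℂ

/-- The tensor product `⨂_i X i` of local operators. -/
def tensor (d : ι → ℕ) (X : ∀ i, Matrix (Fin (d i)) (Fin (d i)) ℂ) : Op d :=
  Matrix.of fun u v => ∏ i, X i (u i) (v i)

/-- Combine values on the systems in `S` with values on the systems outside `S`. -/
def glue {α : ι → Type*} (S : Finset ι) (x : ∀ i : {i // i ∈ S}, α i)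
    (y : ∀ i : {i // ¬ i ∈ S}, α i) : ∀ i, α i :=
  (Equiv.piEquivPiSubtypeProd (fun i => i ∈ S) α).symm (x, y)

/-- The partial trace over all systems outside `T`. -/
def partialTrace (d : ι → ℕ) (T : Finset ι) : Op d →ₗ[ℂ] OpOn d T where
  toFun Y := Matrix.of fun x y => ∑ s : (∀ i : {i // ¬ i ∈ T}, Fin (d i)),
    Y (glue T x s) (glue T y s)
  map_add' Y Y' := by
    ext x y
    simp [Finset.sum_add_distrib]
  map_smul' a Y := by
    ext x y
    simp [Finset.mul_sum]

/-- The partial trace over all systems except the system `j`. -/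
def marginal (d : ι → ℕ) (j : ι) (Y : Op d) : Matrix (Fin (d j)) (Fin (d j)) ℂ :=
  Matrix.of fun x y => ∑ s : (∀ k : {k // k ≠ j}, Fin (d k)),
    Y ((Equiv.piSplitAt j fun k => Fin (d k)).symm (x, s))
      ((Equiv.piSplitAt j fun k => Fin (d k)).symm (y, s))

/-- The map `X ↦ X ⊗ ⨂_{i ∉ S} ρ i` that feeds fixed operators into the systems outside `S`. -/
def insertOps (d : ι → ℕ) (S : Finset ι) (ρ : ∀ i, Matrix (Fin (d i)) (Fin (d i)) ℂ) :
    OpOn d S →ₗ[ℂ] Op d where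
  toFun X := Matrix.of fun u v =>
    X (fun i => u i) (fun i => v i) * ∏ i : {i // ¬ i ∈ S}, ρ i (u i) (v i)
  map_add' X X' := by
    ext u v
    simp [add_mul]
  map_smul' a X := by
    ext u v
    simp [mul_assoc]

/-- The parallel composition `⨂_ν Φ ν` of maps `Φ ν` from the systems `P ν` to the systems `Q ν`,
where the `P ν` partition `S` and the `Q ν` partition `T` (only the inclusions are needed to write
the formula down). It is the linear map that sends `⨂_ν X ν` to `⨂_ν Φ ν (X ν)`. -/
def parallel {κ : Type*} [Fintype κ] {ι' : Type*} [Fintype ι'] [DecidableEq ι']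
    (d : ι → ℕ) (d' : ι' → ℕ) (S : Finset ι) (T : Finset ι')
    (P : κ → Finset ι) (Q : κ → Finset ι') (hP : ∀ ν, P ν ⊆ S) (hQ : ∀ ν, Q ν ⊆ T)
    (Φ : ∀ ν, OpOn d (P ν) →ₗ[ℂ] OpOn d' (Q ν)) : OpOn d S →ₗ[ℂ] OpOn d' T where
  toFun X := Matrix.of fun x y => ∑ u, ∑ v, X u v *
    ∏ ν, Φ ν (Matrix.single (fun i => u ⟨i.1, hP ν i.2⟩) (fun i => v ⟨i.1, hP ν i.2⟩) 1)
      (fun j => x ⟨j.1, hQ ν j.2⟩) (fun j => y ⟨j.1, hQ ν j.2⟩)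
  map_add' X X' := by
    ext x y
    simp [add_mul, Finset.sum_add_distrib]
  map_smul' a X := by
    ext x y
    simp [Finset.mul_sum, mul_assoc]

end Operators

/-- Density operators on `ℂ^d`. -/
def Density (d : ℕ) : Type :=
  {ρ : Matrix (Fin d) (Fin d) ℂ // ρ.PosSemidef ∧ ρ.trace = 1}

/-- Effects on `ℂ^d`: operators `M` with `0 ≤ M ≤ 1`. -/
def Effect (d : ℕ) : Type :=
  {M : Matrix (Fin d) (Fin d) ℂ // M.PosSemidef ∧ (1 - M).PosSemidef}

/-- Complete positivity: `id_k ⊗ Φ` maps positive semidefinite operators to positive semidefinite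
operators, for every `k`. -/
def IsCompletelyPositive {a b : Type*} [Fintype a] [Fintype b]
    (Φ : Matrix a a ℂ →ₗ[ℂ] Matrix b b ℂ) : Prop :=
  ∀ (k : ℕ) (X : Matrix (Fin k × a) (Fin k × a) ℂ), X.PosSemidef →
    (Matrix.of fun (p q : Fin k × b) =>
      Φ (Matrix.of fun i j => X (p.1, i) (q.1, j)) p.2 q.2).PosSemidef

/-- The adjoint `Φ†` of `Φ` for the Hilbert-Schmidt inner product `⟨X, Y⟩ = Tr[Xᴴ Y]`; its matrix
elements are `⟨E_{xy}, Φ†(M)⟩ = ⟨Φ(E_{xy}), M⟩`. -/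
def hsAdjoint {a b : Type*} [Fintype a] [Fintype b] [DecidableEq a]
    (Φ : Matrix a a ℂ →ₗ[ℂ] Matrix b b ℂ) (M : Matrix b b ℂ) : Matrix a a ℂ :=
  Matrix.of fun x y => ((Φ (Matrix.single x y 1)).conjTranspose * M).trace

/-- A multipartite multi-instrument with inputs of dimensions `dA`, outputs of dimensions `dB`,
outcome variable in `C` and setting variable in `Z`: completely positive maps `F_{c|z}` such that
`∑_c F_{c|z}` is trace-preserving for every `z`. -/
structure MultiInstrument {n m : ℕ} (dA : Fin n → ℕ) (dB : Fin m → ℕ) (C Z : Type*)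
    [Fintype C] where
  map : C → Z → (Op dA →ₗ[ℂ] Op dB)
  completelyPositive : ∀ c z, IsCompletelyPositive (map c z)
  tracePreserving : ∀ z X, (∑ c, map c z X).trace = X.trace

section Classicality

variable {n m : ℕ} {dA : Fin n → ℕ} {dB : Fin m → ℕ} {C Z : Type*} [Fintype C]

/-! ### Processes composed from a multi-instrument, local states and local effects -/

/-- The data of an effective process: the multi-instrument with outcome `c` and setting `z`, whose
inputs outside `inputs` are fed with the local states `state i` and whose outputs outside `outputs`
are contracted with the local effects `effect j`. (The states and effects at the remaining open
inputs and outputs are not used.) -/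
structure Box (dA : Fin n → ℕ) (dB : Fin m → ℕ) (C Z : Type*) where
  c : C
  z : Z
  inputs : Finset (Fin n)
  outputs : Finset (Fin m)
  state : ∀ i, Density (dA i)
  effect : ∀ j, Effect (dB j)

/-- The effective process
`X ↦ Tr_{closed outputs}[(1_{open} ⊗ ⨂_{closed} M_j) F_{c|z}(X ⊗ ⨂_{closed} ρ_i)]`. -/
def Box.process (I : MultiInstrument dA dB C Z) (b : Box dA dB C Z) :
    OpOn dA b.inputs →ₗ[ℂ] OpOn dB b.outputs :=
  partialTrace dB b.outputs ∘ₗ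
    LinearMap.mulLeft ℂ (tensor dB fun j => if j ∈ b.outputs then 1 else (b.effect j).1) ∘ₗ
    I.map b.c b.z ∘ₗ
    insertOps dA b.inputs fun i => (b.state i).1

/-- A finite parallel composition of effective processes, with open inputs `S` and open outputs `T`.
The composites of type `(univ, univ)` include the `F_{c|z}` themselves (one box, everything open),
those with a single box are the effective processes. As distinct systems have distinct types, no
output of a box can be wired to an input of another one. -/
structure Composite (dA : Fin n → ℕ) (dB : Fin m → ℕ) (C Z : Type*)
    (S : Finset (Fin n)) (T : Finset (Fin m)) where
  k : ℕ
  box : Fin k → Box dA dB C Z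
  inputs_disjoint : Pairwise fun μ ν => Disjoint (box μ).inputs (box ν).inputs
  outputs_disjoint : Pairwise fun μ ν => Disjoint (box μ).outputs (box ν).outputs
  inputs_union : ∀ i, i ∈ S ↔ ∃ ν, i ∈ (box ν).inputs
  outputs_union : ∀ j, j ∈ T ↔ ∃ ν, j ∈ (box ν).outputs

/-- The linear map implemented by a composite. -/
def Composite.process (I : MultiInstrument dA dB C Z) {S : Finset (Fin n)} {T : Finset (Fin m)}
    (D : Composite dA dB C Z S T) : OpOn dA S →ₗ[ℂ] OpOn dB T :=
  parallel dA dB S T (fun ν => (D.box ν).inputs) (fun ν => (D.box ν).outputs)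
    (fun ν i hi => (D.inputs_union i).2 ⟨ν, hi⟩) (fun ν j hj => (D.outputs_union j).2 ⟨ν, hj⟩)
    (fun ν => (D.box ν).process I)

/-! ### Ontological representations -/

/-- A diagram-preserving assignment: a finite ontic space for each system, and for each state on
`A_i` the weights `p(λ|ρ)`, for each effect on `B_j` the response function `p(M|λ)`, and for each
`F_{c|z}` the matrix `p(c λ_B | z λ_A)`. -/
structure OnticMap (dA : Fin n → ℕ) (dB : Fin m → ℕ) (C Z : Type*)
    (ΛA : Fin n → Type) (ΛB : Fin m → Type) where
  prep : ∀ i, Density (dA i) → ΛA i → ℝ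
  resp : ∀ j, Effect (dB j) → ΛB j → ℝ
  trans : C → Z → (∀ j, ΛB j) → (∀ i, ΛA i) → ℝ

variable {ΛA : Fin n → Type} {ΛB : Fin m → Type} [∀ i, Fintype (ΛA i)] [∀ j, Fintype (ΛB j)]

/-- The ontological representation of an effective process: marginalize over the ontic states of
the closed systems. -/
def OnticMap.box (p : OnticMap dA dB C Z ΛA ΛB) (b : Box dA dB C Z)
    (lB : ∀ j : {j // j ∈ b.outputs}, ΛB j) (lA : ∀ i : {i // i ∈ b.inputs}, ΛA i) : ℝ :=
  ∑ sB : (∀ j : {j // ¬ j ∈ b.outputs}, ΛB j), ∑ sA : (∀ i : {i // ¬ i ∈ b.inputs}, ΛA i),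
    p.trans b.c b.z (glue b.outputs lB sB) (glue b.inputs lA sA) *
      (∏ j : {j // ¬ j ∈ b.outputs}, p.resp j (b.effect j) (sB j)) *
      ∏ i : {i // ¬ i ∈ b.inputs}, p.prep i (b.state i) (sA i)

/-- The ontological representation of a parallel composition: the product. -/
def OnticMap.composite (p : OnticMap dA dB C Z ΛA ΛB) {S : Finset (Fin n)} {T : Finset (Fin m)}
    (D : Composite dA dB C Z S T)
    (lB : ∀ j : {j // j ∈ T}, ΛB j) (lA : ∀ i : {i // i ∈ S}, ΛA i) : ℝ :=
  ∏ ν, p.box (D.box ν) (fun j => lB ⟨j.1, (D.outputs_union j.1).2 ⟨ν, j.2⟩⟩)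
    (fun i => lA ⟨i.1, (D.inputs_union i.1).2 ⟨ν, i.2⟩⟩)

/-- `p` is a linear, diagram-preserving ontological representation of the circuits in which the
multi-instrument is contracted with arbitrary local states and arbitrary local effects. -/
structure IsOntologicalModel (I : MultiInstrument dA dB C Z)
    (p : OnticMap dA dB C Z ΛA ΛB) : Prop where
  /-- states are represented by probability distributions -/
  prep_nonneg : ∀ i ρ l, 0 ≤ p.prep i ρ l
  prep_sum : ∀ i ρ, ∑ l, p.prep i ρ l = 1
  /-- effects are represented by response functions, which sum to one for every POVM -/
  resp_nonneg : ∀ j M l, 0 ≤ p.resp j M l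
  resp_sum : ∀ j (k : ℕ) (M : Fin k → Effect (dB j)), ∑ b, (M b).1 = 1 →
    ∀ l, ∑ b, p.resp j (M b) l = 1
  /-- the multi-instrument is represented by conditional probabilities -/
  trans_nonneg : ∀ c z lB lA, 0 ≤ p.trans c z lB lA
  trans_sum : ∀ z lA, ∑ c, ∑ lB, p.trans c z lB lA = 1
  /-- the quantum statistics are reproduced -/
  adequate : ∀ c z (ρ : ∀ i, Density (dA i)) (M : ∀ j, Effect (dB j)),
    (tensor dB (fun j => (M j).1) * I.map c z (tensor dA fun i => (ρ i).1)).trace =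
      ((∑ lB, ∑ lA, p.trans c z lB lA * (∏ j, p.resp j (M j) (lB j)) *
        ∏ i, p.prep i (ρ i) (lA i) : ℝ) : ℂ)
  /-- operational identities among states are preserved -/
  prep_linear : ∀ i (k : ℕ) (ρ : Fin k → Density (dA i)) (α : Fin k → ℝ),
    ∑ x, (α x : ℂ) • (ρ x).1 = 0 → ∀ l, ∑ x, α x * p.prep i (ρ x) l = 0
  /-- operational identities among effects are preserved -/
  resp_linear : ∀ j (k : ℕ) (M : Fin k → Effect (dB j)) (α : Fin k → ℝ),
    ∑ y, (α y : ℂ) • (M y).1 = 0 → ∀ l, ∑ y, α y * p.resp j (M y) l = 0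
  /-- operational identities among composites of the same type are preserved -/
  composite_linear : ∀ (S : Finset (Fin n)) (T : Finset (Fin m)) (k : ℕ)
    (D : Fin k → Composite dA dB C Z S T) (α : Fin k → ℝ),
    ∑ x, (α x : ℂ) • (D x).process I = 0 →
      ∀ lB lA, ∑ x, α x * p.composite (D x) lB lA = 0

/-- The multi-instrument is classical: the statistics of the set of circuits that contract it with
all factorizing dual processes (a product of local states on the inputs and a product of local
effects on the outputs) admit one linear and diagram-preserving ontological representation, with
finite ontic spaces. -/
def MultiInstrument.IsClassical (I : MultiInstrument dA dB C Z) : Prop :=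
  ∃ (kA : Fin n → ℕ) (kB : Fin m → ℕ)
    (p : OnticMap dA dB C Z (fun i => Fin (kA i)) (fun j => Fin (kB j))), IsOntologicalModel I p

/-! ### Frame representations -/

/-- The operator space `V_{B_j}`: the real span of
`Tr_{B_{j'}, j' ≠ j}[(1 ⊗ ⨂_{j' ≠ j} M_{j'}) F_{c|z}(⨂_i ρ_i)]`. -/
def MultiInstrument.outputSpace (I : MultiInstrument dA dB C Z) (j : Fin m) :
    Submodule ℝ (Matrix (Fin (dB j)) (Fin (dB j)) ℂ) :=
  Submodule.span ℝ {X | ∃ (c : C) (z : Z) (ρ : ∀ i, Density (dA i)) (M : ∀ j, Effect (dB j)),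
    X = marginal dB j (tensor dB (Function.update (fun j' => (M j').1) j 1) *
      I.map c z (tensor dA fun i => (ρ i).1))}

/-- The operator space `V_{A_i}`: the real span of
`Tr_{A_{i'}, i' ≠ i}[(1 ⊗ ⨂_{i' ≠ i} ρ_{i'}) F_{c|z}†(⨂_j M_j)]`. -/
def MultiInstrument.inputSpace (I : MultiInstrument dA dB C Z) (i : Fin n) :
    Submodule ℝ (Matrix (Fin (dA i)) (Fin (dA i)) ℂ) :=
  Submodule.span ℝ {X | ∃ (c : C) (z : Z) (ρ : ∀ i, Density (dA i)) (M : ∀ j, Effect (dB j)),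
    X = marginal dA i (tensor dA (Function.update (fun i' => (ρ i').1) i 1) *
      hsAdjoint (I.map c z) (tensor dB fun j => (M j).1))}

/-- For a real space `V` of Hermitian operators and a Hermitian operator `X`: the operator `Y` is
the orthogonal projection `P_V(X)` for the Hilbert-Schmidt inner product `Tr[X Y]`. -/
def IsProjectionOnto {d : ℕ} (V : Submodule ℝ (Matrix (Fin d) (Fin d) ℂ))
    (X Y : Matrix (Fin d) (Fin d) ℂ) : Prop :=
  Y ∈ V ∧ ∀ W ∈ V, (W * (X - Y)).trace = 0

/-- The Hermitian operators `E` form a frame on the operator space `V` with dual frame `D`, also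
Hermitian: every operator in `V` is reconstructed as `∑ Tr[X D_l] E_l` and as `∑ Tr[X E_l] D_l`. -/
structure IsFrameWithDual {d k : ℕ} (V : Submodule ℝ (Matrix (Fin d) (Fin d) ℂ))
    (E D : Fin k → Matrix (Fin d) (Fin d) ℂ) : Prop where
  frame_hermitian : ∀ l, (E l).IsHermitian
  dual_hermitian : ∀ l, (D l).IsHermitian
  reconstruct : ∀ X ∈ V, X = ∑ l, (X * D l).trace • E l
  reconstruct_dual : ∀ X ∈ V, X = ∑ l, (X * E l).trace • D l

/-- `σ j` with dual `H j` on the output spaces and `F i` with dual `G i` on the input spaces give a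
product frame representation of the multi-instrument with nonnegative coefficients. -/
structure IsFrameRepresentation (I : MultiInstrument dA dB C Z) {kA : Fin n → ℕ} {kB : Fin m → ℕ}
    (σ H : ∀ j, Fin (kB j) → Matrix (Fin (dB j)) (Fin (dB j)) ℂ)
    (F G : ∀ i, Fin (kA i) → Matrix (Fin (dA i)) (Fin (dA i)) ℂ) : Prop where
  output_frame : ∀ j, IsFrameWithDual (I.outputSpace j) (σ j) (H j)
  output_density : ∀ j l, (σ j l).PosSemidef ∧ (σ j l).trace = 1
  output_dual_sum : ∀ j, IsProjectionOnto (I.outputSpace j) 1 (∑ l, H j l)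
  input_frame : ∀ i, IsFrameWithDual (I.inputSpace i) (F i) (G i)
  input_trace : ∀ i l, (F i l).trace = 1
  input_povm : ∀ i l, (G i l).PosSemidef
  input_dual_sum : ∀ i, IsProjectionOnto (I.inputSpace i) 1 (∑ l, G i l) ∧ ∑ l, G i l = 1
  coeff_nonneg : ∀ c z (lA : ∀ i, Fin (kA i)) (lB : ∀ j, Fin (kB j)),
    0 ≤ (tensor dB (fun j => H j (lB j)) * I.map c z (tensor dA fun i => F i (lA i))).trace
  decomposition : ∀ c z (X : Op dA), I.map c z X =
    ∑ lA : (∀ i, Fin (kA i)), ∑ lB : (∀ j, Fin (kB j)),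
      ((tensor dB (fun j => H j (lB j)) * I.map c z (tensor dA fun i => F i (lA i))).trace *
        (tensor dA (fun i => G i (lA i)) * X).trace) • tensor dB fun j => σ j (lB j)

/-- The multi-instrument admits a (finite) product frame representation. -/
def MultiInstrument.AdmitsFrameRepresentation (I : MultiInstrument dA dB C Z) : Prop :=
  ∃ (kA : Fin n → ℕ) (kB : Fin m → ℕ)
    (σ H : ∀ j, Fin (kB j) → Matrix (Fin (dB j)) (Fin (dB j)) ℂ)
    (F G : ∀ i, Fin (kA i) → Matrix (Fin (dA i)) (Fin (dA i)) ℂ), IsFrameRepresentation I σ H F G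

end Classicality

end QProc

end

namespace QProc

/-! ### Positive operators span -/

section Positivity

variable {a : Type*} [Fintype a] [DecidableEq a]

open scoped MatrixOrder Matrix.Norms.L2Operator

/-! Everything is tested on the numbers `pairing`, Tr[(⨂ Y_j) F_{c|z}(⨂ X_i)]. They see Y_j only
through its traces against V_{B_j} and X_i only through its traces against V_{A_i}
(`pairing_congr_output`, `pairing_congr_input`): slots can be changed one at a time, and as effects
and states span, a change in one slot is visible only to the generators of V.

From frames to a model, take p(λ|ρ) = Tr[ρ G_λ], p(M|λ) = Tr[M σ_λ] and the frame coefficients as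
transition probabilities. An effect M and its expansion ∑ Tr[M σ_λ] H_λ have the same traces against
V, and likewise for states. Hence summing over the ontic states of closed systems puts the effects
and states back, and a process is represented by its pairing with the H and F at its open systems
(`ofReal_box`, `ofReal_composite`). This is linear in the process.

From a model to frames, linearity on states and effects gives the POVM G and the densities σ by
Riesz representation (`exists_mem_span_trace_eq`). Linearity on processes with one open system gives
H inside V_B and F inside V_A, and reproduction of the statistics becomes the reconstruction
formula. What remains is positivity of the coefficients, and here parallel composition enters:
F_{c|z} is a real combination of tensor products of one-system processes, whose representations are
products. Preservation of this identity forces p(c λ_B|z λ_A) to be the frame coefficient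
(`IsOntologicalModel.ofReal_trans`). -/

lemma posSemidef_eq_conjTranspose_mul_self {A : Matrix a a ℂ} (hA : A.PosSemidef) :
    ∃ B : Matrix a a ℂ, A = B.conjTranspose * B :=
  CStarAlgebra.nonneg_iff_eq_star_mul_self.1 hA.nonneg

lemma span_posSemidef : Submodule.span ℂ {A : Matrix a a ℂ | A.PosSemidef} = ⊤ := by
  rw [← CStarAlgebra.span_nonneg (A := Matrix a a ℂ)]
  congr 1
  ext A
  exact Matrix.nonneg_iff_posSemidef.symm

lemma trace_mul_nonneg {A B : Matrix a a ℂ} (hA : A.PosSemidef) (hB : B.PosSemidef) :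
    0 ≤ (A * B).trace := by
  obtain ⟨X, rfl⟩ := posSemidef_eq_conjTranspose_mul_self hA
  rw [Matrix.mul_assoc, Matrix.trace_mul_comm]
  exact (hB.mul_mul_conjTranspose_same X).trace_nonneg

lemma PosSemidef.exists_le_smul_one {A : Matrix a a ℂ} (hA : A.PosSemidef) :
    ∃ r : ℝ, 0 < r ∧ ((r : ℂ) • (1 : Matrix a a ℂ) - A).PosSemidef := by
  have hs : IsSelfAdjoint A := hA.isHermitian
  have h := hs.le_algebraMap_norm_self
  -- The norm already suffices as a bound; adding 1 makes the factor invertible when `A = 0`.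
  refine ⟨‖A‖ + 1, by positivity, ?_⟩
  have h1 : (algebraMap ℝ (Matrix a a ℂ) ‖A‖ - A).PosSemidef := h
  have h2 : algebraMap ℝ (Matrix a a ℂ) ‖A‖ = (‖A‖ : ℂ) • (1 : Matrix a a ℂ) := by
    rw [Algebra.algebraMap_eq_smul_one]
    ext i j
    simp [Matrix.smul_apply]
  rw [h2] at h1
  have h3 := h1.add (Matrix.PosSemidef.one (n := a) (R := ℂ))
  convert h3 using 1
  push_cast
  module

end Positivity

lemma eq_zero_of_forall_trace_mul {a : Type*} [Fintype a] {A : Matrix a a ℂ}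
    (h : ∀ B, (B * A).trace = 0) : A = 0 :=
  Matrix.trace_conjTranspose_mul_self_eq_zero_iff.1 (h A.conjTranspose)

lemma trace_mul_im_eq_zero {a : Type*} [Fintype a] {A B : Matrix a a ℂ}
    (hA : A.IsHermitian) (hB : B.IsHermitian) : (A * B).trace.im = 0 := by
  have h : star (A * B).trace = (A * B).trace := by
    rw [← Matrix.trace_conjTranspose, Matrix.conjTranspose_mul, hA.eq, hB.eq,
      Matrix.trace_mul_comm]
  exact Complex.conj_eq_iff_im.1 h

lemma ofReal_re_trace_mul {a : Type*} [Fintype a] {A B : Matrix a a ℂ}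
    (hA : A.IsHermitian) (hB : B.IsHermitian) : ((A * B).trace.re : ℂ) = (A * B).trace :=
  Complex.conj_eq_iff_re.1 (Complex.conj_eq_iff_im.2 (trace_mul_im_eq_zero hA hB))

/-! ### States and effects as spanning families of test operators -/

section LocalSpans

variable {d : ℕ}

lemma exists_effect_smul {A : Matrix (Fin d) (Fin d) ℂ} (hA : A.PosSemidef) :
    ∃ (r : ℝ) (M : Effect d), 0 ≤ r ∧ A = (r : ℂ) • M.1 := by
  obtain ⟨r, hr, h⟩ := PosSemidef.exists_le_smul_one hA
  have hr' : (0 : ℂ) ≤ ((r⁻¹ : ℝ) : ℂ) := by exact_mod_cast (inv_pos.2 hr).le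
  have hrc : (r : ℂ) ≠ 0 := by exact_mod_cast hr.ne'
  refine ⟨r, ⟨((r⁻¹ : ℝ) : ℂ) • A, hA.smul hr', ?_⟩, hr.le, ?_⟩
  · have := h.smul hr'
    rw [smul_sub, smul_smul] at this
    simpa [hrc] using this
  · simp [smul_smul, hrc]

lemma exists_density_smul {A : Matrix (Fin d) (Fin d) ℂ} (hA : A.PosSemidef) :
    A = 0 ∨ ∃ (r : ℝ) (ρ : Density d), 0 ≤ r ∧ A = (r : ℂ) • ρ.1 := by
  have ht := hA.trace_nonneg
  by_cases h0 : A.trace = 0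
  · exact Or.inl (hA.trace_eq_zero_iff.1 h0)
  · right
    rw [Complex.nonneg_iff] at ht
    have hre : A.trace = (A.trace.re : ℂ) := by
      apply Complex.ext <;> simp [← ht.2]
    have hr' : (0 : ℂ) ≤ A.trace⁻¹ := by
      rw [hre, ← Complex.ofReal_inv]
      exact_mod_cast inv_nonneg.2 ht.1
    refine ⟨A.trace.re, ⟨A.trace⁻¹ • A, hA.smul hr', ?_⟩, ht.1, ?_⟩
    · simp [Matrix.trace_smul, h0]
    · rw [← hre]
      simp [smul_smul, h0]

lemma span_effect :
    Submodule.span ℂ (Set.range fun M : Effect d => M.1) = ⊤ := by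
  rw [eq_top_iff, ← span_posSemidef, Submodule.span_le]
  intro A hA
  obtain ⟨r, M, -, rfl⟩ := exists_effect_smul hA
  exact Submodule.smul_mem _ _ (Submodule.subset_span ⟨M, rfl⟩)

lemma span_density :
    Submodule.span ℂ (Set.range fun ρ : Density d => ρ.1) = ⊤ := by
  rw [eq_top_iff, ← span_posSemidef, Submodule.span_le]
  intro A hA
  obtain rfl | ⟨r, M, -, rfl⟩ := exists_density_smul hA
  · exact Submodule.zero_mem _
  · exact Submodule.smul_mem _ _ (Submodule.subset_span ⟨M, rfl⟩)

lemma eq_zero_of_trace_mul_of_span {s : Set (Matrix (Fin d) (Fin d) ℂ)}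
    (hs : Submodule.span ℂ s = ⊤) {A : Matrix (Fin d) (Fin d) ℂ}
    (h : ∀ M ∈ s, (M * A).trace = 0) : A = 0 := by
  refine eq_zero_of_forall_trace_mul fun B => ?_
  have hB : B ∈ Submodule.span ℂ s := by
    rw [hs]; trivial
  induction hB using Submodule.span_induction with
  | mem x hx => exact h x hx
  | zero => simp
  | add x y _ _ hx hy => simp [add_mul, hx, hy]
  | smul c x _ hx => simp [hx]

lemma eq_zero_of_forall_effect {A : Matrix (Fin d) (Fin d) ℂ}
    (h : ∀ M : Effect d, (M.1 * A).trace = 0) : A = 0 :=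
  eq_zero_of_trace_mul_of_span span_effect (by rintro _ ⟨M, rfl⟩; exact h M)

lemma eq_zero_of_forall_density {A : Matrix (Fin d) (Fin d) ℂ}
    (h : ∀ ρ : Density d, (ρ.1 * A).trace = 0) : A = 0 :=
  eq_zero_of_trace_mul_of_span span_density (by rintro _ ⟨M, rfl⟩; exact h M)

/-- For Hermitian `M`, Tr[M Aᴴ] is the conjugate of Tr[M A], so real traces make `Aᴴ - A` vanish
against a spanning set. -/
lemma isHermitian_of_trace_mul {s : Set (Matrix (Fin d) (Fin d) ℂ)}
    (hs : Submodule.span ℂ s = ⊤) (hH : ∀ M ∈ s, M.IsHermitian)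
    {A : Matrix (Fin d) (Fin d) ℂ} (h : ∀ M ∈ s, (M * A).trace.im = 0) : A.IsHermitian := by
  have : A.conjTranspose - A = 0 := by
    refine eq_zero_of_trace_mul_of_span hs fun M hM => ?_
    have h1 : (M * A.conjTranspose).trace = star (M * A).trace := by
      rw [← Matrix.trace_conjTranspose, Matrix.conjTranspose_mul, (hH M hM).eq,
        Matrix.trace_mul_comm]
    rw [Matrix.mul_sub, Matrix.trace_sub, h1, sub_eq_zero]
    exact Complex.conj_eq_iff_im.2 (h M hM)
  exact sub_eq_zero.1 this

/-- The rank-one tests x xᴴ give exactly the quadratic form of `A`. -/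
lemma posSemidef_of_trace_mul {A : Matrix (Fin d) (Fin d) ℂ} (hA : A.IsHermitian)
    (h : ∀ P : Matrix (Fin d) (Fin d) ℂ, P.PosSemidef → 0 ≤ (P * A).trace.re) :
    A.PosSemidef := by
  refine Matrix.PosSemidef.of_dotProduct_mulVec_nonneg hA fun x => ?_
  have hP := Matrix.posSemidef_vecMulVec_self_star x
  have h1 : (Matrix.vecMulVec x (star x) * A).trace = star x ⬝ᵥ (A.mulVec x) := by
    rw [Matrix.trace_mul_comm, Matrix.mul_vecMulVec, Matrix.trace_vecMulVec, dotProduct_comm]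
  rw [← h1, ← ofReal_re_trace_mul hP.isHermitian hA]
  exact_mod_cast h _ hP

lemma posSemidef_of_forall_effect {A : Matrix (Fin d) (Fin d) ℂ} (hA : A.IsHermitian)
    (h : ∀ M : Effect d, 0 ≤ (M.1 * A).trace.re) : A.PosSemidef := by
  refine posSemidef_of_trace_mul hA fun P hP => ?_
  obtain ⟨r, M, hr, rfl⟩ := exists_effect_smul hP
  simpa using mul_nonneg hr (h M)

lemma posSemidef_of_forall_density {A : Matrix (Fin d) (Fin d) ℂ} (hA : A.IsHermitian)
    (h : ∀ ρ : Density d, 0 ≤ (ρ.1 * A).trace.re) : A.PosSemidef := by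
  refine posSemidef_of_trace_mul hA fun P hP => ?_
  obtain rfl | ⟨r, M, hr, rfl⟩ := exists_density_smul hP
  · simp
  · simpa using mul_nonneg hr (h M)

lemma nonempty_density (hd : 0 < d) : Nonempty (Density d) := by
  have : Nonempty (Fin d) := ⟨⟨0, hd⟩⟩
  obtain h | ⟨-, ρ, -, -⟩ := exists_density_smul (Matrix.PosSemidef.one (n := Fin d) (R := ℂ))
  · exact absurd h one_ne_zero
  · exact ⟨ρ⟩

/-- The effect `1`. -/
def Effect.unit (d : ℕ) : Effect d :=
  ⟨1, Matrix.PosSemidef.one, by simpa using Matrix.PosSemidef.zero⟩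

lemma Effect.coe_unit (d : ℕ) : (Effect.unit d).1 = 1 := rfl

end LocalSpans

/-! ### Representation of real functionals on spaces of Hermitian operators -/

lemma isHermitian_of_mem_span {d : ℕ} {s : Set (Matrix (Fin d) (Fin d) ℂ)}
    (hs : ∀ X ∈ s, X.IsHermitian) {X : Matrix (Fin d) (Fin d) ℂ}
    (hX : X ∈ Submodule.span ℝ s) : X.IsHermitian := by
  induction hX using Submodule.span_induction with
  | mem x hx => exact hs x hx
  | zero => exact Matrix.isHermitian_zero
  | add x y _ _ hx hy => exact hx.add hy
  | smul c x _ hx =>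
    unfold Matrix.IsHermitian
    rw [Matrix.conjTranspose_smul, hx.eq]
    simp

/-- A function on a family of Hermitian operators that respects all linear relations is
represented, for the Hilbert-Schmidt inner product, by an operator in the span of the family. -/
lemma exists_mem_span_trace_eq {d : ℕ} {ι : Type*} (g : ι → Matrix (Fin d) (Fin d) ℂ)
    (hg : ∀ a, (g a).IsHermitian) (f : ι → ℝ)
    (h : ∀ (k : ℕ) (x : Fin k → ι) (α : Fin k → ℝ),
      ∑ b, α b • g (x b) = 0 → ∑ b, α b * f (x b) = 0) :
    ∃ G ∈ Submodule.span ℝ (Set.range g), ∀ a, (g a * G).trace = f a := by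
  classical
  set V := Submodule.span ℝ (Set.range g) with hV
  have hH : ∀ X ∈ V, X.IsHermitian := fun X hX =>
    isHermitian_of_mem_span (by rintro _ ⟨a, rfl⟩; exact hg a) hX
  have hker : ∀ c : ι →₀ ℝ, Finsupp.linearCombination ℝ g c = 0 →
      Finsupp.linearCombination ℝ f c = 0 := by
    intro c hc
    let e := c.support.equivFin.symm
    have key := h _ (fun b => (e b : ι)) (fun b => c (e b)) ?_
    · rw [Finsupp.linearCombination_apply, Finsupp.sum, ← Finset.sum_coe_sort, ← e.sum_comp]
      simpa using key
    · rw [Finsupp.linearCombination_apply, Finsupp.sum, ← Finset.sum_coe_sort,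
        ← e.sum_comp] at hc
      exact hc
  have hrange : LinearMap.range (Finsupp.linearCombination ℝ g) = V :=
    Finsupp.range_linearCombination ℝ
  -- A linear section chooses coefficients for each element of the span; by `hker` the value
  -- assigned by `f` does not depend on that choice.
  obtain ⟨s, hs⟩ := (Finsupp.linearCombination ℝ g).rangeRestrict.exists_rightInverse_of_surjective
    (LinearMap.range_rangeRestrict _)
  have hs' : ∀ X, Finsupp.linearCombination ℝ g (s X) = X := fun X =>
    congrArg Subtype.val (LinearMap.congr_fun hs X)
  -- the pairing as an injective map from the span to its dual
  let B : V →ₗ[ℝ] Module.Dual ℝ V :=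
    LinearMap.mk₂ ℝ (fun X Y => (X.1 * Y.1).trace.re)
      (fun X X' Y => by simp [add_mul]) (fun r X Y => by simp)
      (fun X Y Y' => by simp [mul_add]) (fun r X Y => by simp)
  -- On Hermitian operators Tr[X X] = Tr[Xᴴ X], so the real trace form is definite; finite dimension
  -- then gives surjectivity.
  have hB : Function.Injective B := by
    refine (injective_iff_map_eq_zero B).2 fun X hX => ?_
    have h1 : (X.1 * X.1).trace.re = 0 := LinearMap.congr_fun hX X
    have h2 := ofReal_re_trace_mul (hH X.1 X.2) (hH X.1 X.2)
    rw [h1] at h2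
    apply Subtype.ext
    refine Matrix.trace_conjTranspose_mul_self_eq_zero_iff.1 ?_
    rw [(hH X.1 X.2).eq, ← h2]
    simp
  have hBs : Function.Surjective B :=
    (LinearMap.injective_iff_surjective_of_finrank_eq_finrank
      Subspace.dual_finrank_eq.symm).1 hB
  let L : Module.Dual ℝ V := Finsupp.linearCombination ℝ f ∘ₗ s ∘ₗ
    (LinearEquiv.ofEq _ _ hrange.symm).toLinearMap
  obtain ⟨G, hG⟩ := hBs L
  refine ⟨G.1, G.2, fun a => ?_⟩
  have ha : g a ∈ V := Submodule.subset_span ⟨a, rfl⟩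
  have h1 : (G.1 * g a).trace.re = L ⟨g a, ha⟩ := LinearMap.congr_fun hG ⟨g a, ha⟩
  have h2 : L ⟨g a, ha⟩ = f a := by
    have h3 := hker (s ⟨g a, hrange ▸ ha⟩ - Finsupp.single a 1) (by
      rw [map_sub, hs']
      simp)
    rw [map_sub, sub_eq_zero] at h3
    exact h3.trans (by simp)
  rw [Matrix.trace_mul_comm, ← ofReal_re_trace_mul (hH _ G.2) (hg a), h1, h2]

/-! ### Tensor products of local operators -/

section Tensor

variable {ι : Type*} [Fintype ι] [DecidableEq ι] {d : ι → ℕ}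

omit [DecidableEq ι] in
lemma tensor_apply (X : ∀ i, Matrix (Fin (d i)) (Fin (d i)) ℂ) (u v : ∀ i, Fin (d i)) :
    tensor d X u v = ∏ i, X i (u i) (v i) := rfl

lemma tensor_mul (X Y : ∀ i, Matrix (Fin (d i)) (Fin (d i)) ℂ) :
    tensor d X * tensor d Y = tensor d fun i => X i * Y i := by
  ext u v
  simp only [Matrix.mul_apply, tensor_apply, ← Finset.prod_mul_distrib]
  rw [Fintype.prod_sum]

lemma trace_tensor (X : ∀ i, Matrix (Fin (d i)) (Fin (d i)) ℂ) :
    (tensor d X).trace = ∏ i, (X i).trace := by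
  simp only [Matrix.trace, Matrix.diag, tensor_apply]
  rw [Fintype.prod_sum]

omit [DecidableEq ι] in
lemma conjTranspose_tensor (X : ∀ i, Matrix (Fin (d i)) (Fin (d i)) ℂ) :
    (tensor d X).conjTranspose = tensor d fun i => (X i).conjTranspose := by
  ext u v
  simp [tensor_apply, Matrix.conjTranspose_apply]

lemma tensor_one : tensor d (fun _ => 1) = 1 := by
  ext u v
  simp only [tensor_apply, Matrix.one_apply, Finset.prod_ite_zero, Finset.prod_const_one]
  simp [funext_iff]

lemma tensor_single (u v : ∀ i, Fin (d i)) :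
    tensor d (fun i => Matrix.single (u i) (v i) 1) = Matrix.single u v 1 := by
  ext x y
  simp only [tensor_apply, Matrix.single_apply, Finset.prod_ite_zero, Finset.prod_const_one]
  simp [funext_iff, forall_and]

lemma tensor_posSemidef {X : ∀ i, Matrix (Fin (d i)) (Fin (d i)) ℂ}
    (hX : ∀ i, (X i).PosSemidef) : (tensor d X).PosSemidef := by
  choose Y hY using fun i => posSemidef_eq_conjTranspose_mul_self (hX i)
  have : tensor d X = (tensor d Y).conjTranspose * tensor d Y := by
    rw [conjTranspose_tensor, tensor_mul]
    congr 1
    exact funext hY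
  rw [this]
  exact Matrix.posSemidef_conjTranspose_mul_self _

/-- `tensor` as a multilinear map. -/
def tensorMul (d : ι → ℕ) :
    MultilinearMap ℂ (fun i => Matrix (Fin (d i)) (Fin (d i)) ℂ) (Op d) where
  toFun := tensor d
  map_update_add' X i x y := by
    ext u v
    simp only [tensor_apply, Matrix.add_apply]
    rw [← Finset.mul_prod_erase _ _ (Finset.mem_univ i),
      ← Finset.mul_prod_erase _ _ (Finset.mem_univ i),
      ← Finset.mul_prod_erase _ _ (Finset.mem_univ i)]
    simp only [Function.update_self, Matrix.add_apply, add_mul]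
    congr 2 <;> refine Finset.prod_congr rfl fun k hk => ?_ <;>
      simp [Function.update_of_ne (Finset.ne_of_mem_erase hk)]
  map_update_smul' X i c x := by
    ext u v
    simp only [tensor_apply, Matrix.smul_apply]
    rw [← Finset.mul_prod_erase _ _ (Finset.mem_univ i),
      ← Finset.mul_prod_erase _ _ (Finset.mem_univ i)]
    simp only [Function.update_self, Matrix.smul_apply, smul_eq_mul, mul_assoc]
    congr 2
    refine Finset.prod_congr rfl fun k hk => ?_
    simp [Function.update_of_ne (Finset.ne_of_mem_erase hk)]

end Tensor

/-! ### Multilinear maps and spanning sets -/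

section Multilinear

/-- A multilinear map that sends product sets into a submodule sends the product of their spans
into it. -/
lemma multilinear_mem_of_mem_span {R ι M : Type*} [CommRing R] [Fintype ι] [DecidableEq ι]
    {E : ι → Type*} [∀ i, AddCommGroup (E i)] [∀ i, Module R (E i)] [AddCommGroup M] [Module R M]
    (f : MultilinearMap R E M) (U : Submodule R M) (s : ∀ i, Set (E i))
    (h : ∀ x, (∀ i, x i ∈ s i) → f x ∈ U) (x : ∀ i, E i)
    (hx : ∀ i, x i ∈ Submodule.span R (s i)) : f x ∈ U := by
  -- Induction on the set `t` of slots whose arguments are only known to lie in the span.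
  suffices key : ∀ t : Finset ι, ∀ x : ∀ i, E i, (∀ i, x i ∈ Submodule.span R (s i)) →
      (∀ i ∉ t, x i ∈ s i) → f x ∈ U from
    key Finset.univ x hx (by simp)
  intro t
  induction t using Finset.induction_on with
  | empty => exact fun x _ hx => h x (by simpa using hx)
  | insert a t ha ih =>
    intro x hxs hx
    suffices ∀ y ∈ Submodule.span R (s a), f (Function.update x a y) ∈ U by
      simpa using this _ (hxs a)
    intro y hy
    induction hy using Submodule.span_induction with
    | mem y hy =>
      refine ih _ (fun i => ?_) fun i hi => ?_
      · by_cases hia : i = a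
        · subst hia; simpa using Submodule.subset_span hy
        · simpa [hia] using hxs i
      · by_cases hia : i = a
        · subst hia; simpa using hy
        · simpa [hia] using hx i (by simp [hia, hi])
    | zero => simp
    | add y z _ _ h1 h2 => rw [f.map_update_add]; exact U.add_mem h1 h2
    | smul c y _ h1 => rw [f.map_update_smul]; exact U.smul_mem c h1

variable {ι : Type*} [Fintype ι] [DecidableEq ι] {E : ι → Type*} [∀ i, AddCommGroup (E i)]
  [∀ i, Module ℂ (E i)]

/-- A multilinear form that vanishes on product sets vanishes on the product of their spans. -/
lemma multilinear_eq_zero_of_mem_span (f : MultilinearMap ℂ E ℂ) (s : ∀ i, Set (E i))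
    (h : ∀ x, (∀ i, x i ∈ s i) → f x = 0) (x : ∀ i, E i)
    (hx : ∀ i, x i ∈ Submodule.span ℂ (s i)) : f x = 0 :=
  (Submodule.mem_bot ℂ).1 (multilinear_mem_of_mem_span f ⊥ s
    (fun x hx => (Submodule.mem_bot ℂ).2 (h x hx)) x hx)

/-- Spanning frees all slots except `i`, which is held at `v` by taking {v} as its generating set.
The element of `s i` only completes a tuple of generators, since that slot is overwritten. -/
lemma multilinear_update_eq_zero (f : MultilinearMap ℂ E ℂ) (s : ∀ i, Set (E i))
    (hs : ∀ i, Submodule.span ℂ (s i) = ⊤) (i : ι) (hi : (s i).Nonempty) (v : E i)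
    (h : ∀ x, (∀ k, x k ∈ s k) → f (Function.update x i v) = 0) (x : ∀ i, E i) :
    f (Function.update x i v) = 0 := by
  obtain ⟨w, hw⟩ := hi
  refine multilinear_eq_zero_of_mem_span f (Function.update s i {v}) (fun y hy => ?_) _
    fun k => ?_
  · have hyi : y i = v := by simpa using hy i
    have h1 := h (Function.update y i w) fun k => by
      by_cases hk : k = i
      · subst hk; simpa using hw
      · simpa [hk] using hy k
    rwa [Function.update_idem, ← hyi, Function.update_eq_self] at h1
  · by_cases hk : k = i
    · subst hk; simp
    · simp [hk, hs]

/-- Two arguments of a multilinear form that cannot be distinguished in any single slot give the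
same value. -/
lemma multilinear_congr_of_update (f : MultilinearMap ℂ E ℂ) (Y Y' : ∀ i, E i)
    (h : ∀ i (X : ∀ i, E i), f (Function.update X i (Y i - Y' i)) = 0) : f Y = f Y' := by
  -- Hybrid argument: the entries of `Y` are exchanged for those of `Y'` one slot at a time.
  have key : ∀ t : Finset ι, f (t.piecewise Y' Y) = f Y := by
    intro t
    induction t using Finset.induction_on with
    | empty => simp
    | insert a t ha ih =>
      rw [← ih, Finset.piecewise_insert]
      have h1 := h a (t.piecewise Y' Y)
      rw [f.map_update_sub, sub_eq_zero] at h1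
      rw [← h1]
      congr 1
      ext i
      by_cases hia : i = a
      · subst hia; simp [ha]
      · simp [hia]
  simpa using (key Finset.univ).symm

end Multilinear

/-! ### Testing linear maps on product operators -/

section Testing

variable {ι : Type*} [Fintype ι] [DecidableEq ι] {d : ι → ℕ}
  {ι' : Type*} [Fintype ι'] [DecidableEq ι'] {d' : ι' → ℕ}

/-- The value of a map between operator spaces on a product operator, contracted with a product
operator. -/
def pairing (Φ : Op d →ₗ[ℂ] Op d') (Y : ∀ j, Matrix (Fin (d' j)) (Fin (d' j)) ℂ)
    (X : ∀ i, Matrix (Fin (d i)) (Fin (d i)) ℂ) : ℂ :=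
  (tensor d' Y * Φ (tensor d X)).trace

/-- `pairing` as a multilinear form in the output operators. -/
def pairingOut (Φ : Op d →ₗ[ℂ] Op d') (X : ∀ i, Matrix (Fin (d i)) (Fin (d i)) ℂ) :
    MultilinearMap ℂ (fun j => Matrix (Fin (d' j)) (Fin (d' j)) ℂ) ℂ :=
  (Matrix.traceLinearMap _ ℂ ℂ ∘ₗ LinearMap.mulRight ℂ (Φ (tensor d X))).compMultilinearMap
    (tensorMul d')

/-- `pairing` as a multilinear form in the input operators. -/
def pairingIn (Φ : Op d →ₗ[ℂ] Op d') (Y : ∀ j, Matrix (Fin (d' j)) (Fin (d' j)) ℂ) :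
    MultilinearMap ℂ (fun i => Matrix (Fin (d i)) (Fin (d i)) ℂ) ℂ :=
  (Matrix.traceLinearMap _ ℂ ℂ ∘ₗ LinearMap.mulLeft ℂ (tensor d' Y) ∘ₗ Φ).compMultilinearMap
    (tensorMul d)

omit [DecidableEq ι] in
lemma pairingOut_apply (Φ : Op d →ₗ[ℂ] Op d') (Y : ∀ j, Matrix (Fin (d' j)) (Fin (d' j)) ℂ)
    (X : ∀ i, Matrix (Fin (d i)) (Fin (d i)) ℂ) : pairingOut Φ X Y = pairing Φ Y X := rfl

omit [DecidableEq ι] in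
lemma pairingIn_apply (Φ : Op d →ₗ[ℂ] Op d') (Y : ∀ j, Matrix (Fin (d' j)) (Fin (d' j)) ℂ)
    (X : ∀ i, Matrix (Fin (d i)) (Fin (d i)) ℂ) : pairingIn Φ Y X = pairing Φ Y X := rfl

/-- Matrix units of the full space are tensor products of local matrix units, so product tests read
off every matrix element. -/
lemma eq_of_pairing_eq {Φ Ψ : Op d →ₗ[ℂ] Op d'}
    (h : ∀ Y X, pairing Φ Y X = pairing Ψ Y X) : Φ = Ψ := by
  refine Matrix.ext_linearMap _ fun u v => ?_
  ext1
  ext x y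
  have := h (fun i => Matrix.single (y i) (x i) 1) (fun i => Matrix.single (u i) (v i) 1)
  simp only [pairing, tensor_single, Matrix.trace_single_mul] at this
  simpa using this

omit [DecidableEq ι] in
lemma pairing_sum_smul {κ : Type*} [Fintype κ] (α : κ → ℂ) (Φ : κ → Op d →ₗ[ℂ] Op d')
    (Y : ∀ j, Matrix (Fin (d' j)) (Fin (d' j)) ℂ) (X : ∀ i, Matrix (Fin (d i)) (Fin (d i)) ℂ) :
    pairing (∑ a, α a • Φ a) Y X = ∑ a, α a * pairing (Φ a) Y X := by
  simp [pairing, Matrix.mul_sum, Matrix.trace_sum]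

/-- The pairing in terms of matrix elements. -/
lemma pairing_eq_sum (Φ : Op d →ₗ[ℂ] Op d') (Y : ∀ j, Matrix (Fin (d' j)) (Fin (d' j)) ℂ)
    (X : ∀ i, Matrix (Fin (d i)) (Fin (d i)) ℂ) :
    pairing Φ Y X = ∑ y, ∑ x, ∑ u, ∑ v,
      (∏ j, Y j (y j) (x j)) * ((∏ i, X i (u i) (v i)) * Φ (Matrix.single u v 1) x y) := by
  have h1 : Φ (tensor d X) = ∑ u, ∑ v, tensor d X u v • Φ (Matrix.single u v 1) := by
    conv_lhs => rw [Matrix.matrix_eq_sum_single (tensor d X)]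
    simp only [map_sum, ← map_smul, Matrix.smul_single, smul_eq_mul, mul_one]
  simp only [pairing, Matrix.trace, Matrix.diag, Matrix.mul_apply, h1, Matrix.sum_apply,
    Matrix.smul_apply, tensor_apply, Finset.mul_sum, smul_eq_mul]

end Testing

/-! ### Splitting the systems into two groups -/

section Glue

variable {ι : Type*} [Fintype ι] [DecidableEq ι] {α : ι → Type*} (S : Finset ι)

omit [Fintype ι] in
lemma glue_of_mem (x : ∀ i : {i // i ∈ S}, α i) (y : ∀ i : {i // ¬ i ∈ S}, α i)
    {i : ι} (h : i ∈ S) : glue S x y i = x ⟨i, h⟩ := by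
  simp [glue, Equiv.piEquivPiSubtypeProd, h]

omit [Fintype ι] in
lemma glue_of_notMem (x : ∀ i : {i // i ∈ S}, α i) (y : ∀ i : {i // ¬ i ∈ S}, α i)
    {i : ι} (h : ¬ i ∈ S) : glue S x y i = y ⟨i, h⟩ := by
  simp [glue, Equiv.piEquivPiSubtypeProd, h]

omit [Fintype ι] in
@[simp] lemma glue_coe (x : ∀ i : {i // i ∈ S}, α i) (y : ∀ i : {i // ¬ i ∈ S}, α i)
    (i : {i // i ∈ S}) : glue S x y i = x i := glue_of_mem S x y i.2

omit [Fintype ι] in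
@[simp] lemma glue_coe' (x : ∀ i : {i // i ∈ S}, α i) (y : ∀ i : {i // ¬ i ∈ S}, α i)
    (i : {i // ¬ i ∈ S}) : glue S x y i = y i := glue_of_notMem S x y i.2

lemma sum_glue {M : Type*} [AddCommMonoid M] [∀ i, Fintype (α i)] (f : (∀ i, α i) → M) :
    ∑ u, f u = ∑ x, ∑ y, f (glue S x y) := by
  rw [← Fintype.sum_prod_type' (f := fun x y => f (glue S x y))]
  exact ((Equiv.piEquivPiSubtypeProd (fun i => i ∈ S) α).symm.sum_comp f).symm

lemma prod_mul_prod_notMem {M : Type*} [CommMonoid M] (h : ι → M) :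
    ∏ i, h i = (∏ i : {i // i ∈ S}, h i) * ∏ i : {i // ¬ i ∈ S}, h i := by
  rw [← Fintype.prod_subtype_mul_prod_subtype (fun i => i ∈ S) h]
  congr 1
  exact Finset.prod_congr (by ext; simp) fun _ _ => rfl

end Glue

/-! ### Partial trace and insertion, tested on product operators -/

section Reduction

variable {ι : Type*} [Fintype ι] [DecidableEq ι] (d : ι → ℕ)

/-- Partial trace is dual to tensoring with the identity: the identities on the traced systems force
their row and column indices to agree. -/
lemma trace_tensor_mul_partialTrace (T : Finset ι)
    (Y : ∀ i : {i // i ∈ T}, Matrix (Fin (d i)) (Fin (d i)) ℂ) (Z : Op d) :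
    (tensor (fun i : {i // i ∈ T} => d i) Y * partialTrace d T Z).trace =
      (tensor d (glue T Y fun _ => 1) * Z).trace := by
  simp only [Matrix.trace, Matrix.diag, Matrix.mul_apply]
  rw [sum_glue T]
  refine Finset.sum_congr rfl fun x _ => ?_
  rw [Finset.sum_congr rfl fun s _ => sum_glue T (α := fun i => Fin (d i)) _, Finset.sum_comm]
  simp only [tensor_apply, prod_mul_prod_notMem T, glue_coe, glue_coe', Matrix.one_apply,
    Finset.prod_ite_zero, Finset.prod_const_one]
  refine Finset.sum_congr rfl fun y _ => ?_
  simp only [partialTrace, LinearMap.coe_mk, AddHom.coe_mk, Matrix.of_apply, Finset.mul_sum]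
  refine Finset.sum_congr rfl fun s _ => ?_
  rw [Finset.sum_eq_single s]
  · simp
  · intro t _ hts
    have : ¬ ∀ i ∈ (Finset.univ : Finset {i // ¬ i ∈ T}), s i = t i := fun h =>
      hts (funext fun i => (h i (Finset.mem_univ i)).symm)
    rw [if_neg this]
    simp
  · simp

lemma insertOps_tensor (S : Finset ι) (ρ : ∀ i, Matrix (Fin (d i)) (Fin (d i)) ℂ)
    (X : ∀ i : {i // i ∈ S}, Matrix (Fin (d i)) (Fin (d i)) ℂ) :
    insertOps d S ρ (tensor (fun i : {i // i ∈ S} => d i) X) =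
      tensor d (glue S X fun i => ρ i) := by
  ext u v
  simp only [insertOps, LinearMap.coe_mk, AddHom.coe_mk, Matrix.of_apply, tensor_apply]
  rw [prod_mul_prod_notMem S]
  simp only [glue_coe, glue_coe']

lemma trace_mul_marginal (j : ι) (Y : Matrix (Fin (d j)) (Fin (d j)) ℂ) (Z : Op d) :
    (Y * marginal d j Z).trace = (tensor d (Function.update (fun _ => 1) j Y) * Z).trace := by
  have hsum : ∀ f : (∀ i, Fin (d i)) → ℂ, ∑ u, f u =
      ∑ x, ∑ s, f ((Equiv.piSplitAt j fun k => Fin (d k)).symm (x, s)) := fun f => by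
    rw [← Fintype.sum_prod_type'
      (f := fun x s => f ((Equiv.piSplitAt j fun k => Fin (d k)).symm (x, s)))]
    exact ((Equiv.piSplitAt j fun k => Fin (d k)).symm.sum_comp f).symm
  have hprod : ∀ x s y t, tensor d (Function.update (fun _ => 1) j Y)
      ((Equiv.piSplitAt j fun k => Fin (d k)).symm (x, s))
      ((Equiv.piSplitAt j fun k => Fin (d k)).symm (y, t)) = Y x y * if s = t then 1 else 0 := by
    intro x s y t
    rw [tensor_apply, ← Finset.mul_prod_erase _ _ (Finset.mem_univ j),
      Finset.prod_subtype (p := fun i => i ≠ j) _ (by simp)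
        (fun i => Function.update (fun i => (1 : Matrix (Fin (d i)) (Fin (d i)) ℂ)) j Y i
          ((Equiv.piSplitAt j fun k => Fin (d k)).symm (x, s) i)
          ((Equiv.piSplitAt j fun k => Fin (d k)).symm (y, t) i))]
    congr 1
    · simp [Equiv.piSplitAt]
    · have : ∀ i : {i // i ≠ j},
          Function.update (fun i => (1 : Matrix (Fin (d i)) (Fin (d i)) ℂ)) j Y i.1
          ((Equiv.piSplitAt j fun k => Fin (d k)).symm (x, s) i)
          ((Equiv.piSplitAt j fun k => Fin (d k)).symm (y, t) i) =
          if s i = t i then 1 else 0 := by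
        rintro ⟨i, hi⟩
        simp [Equiv.piSplitAt, hi, Matrix.one_apply]
      rw [Fintype.prod_congr _ _ this, Finset.prod_ite_zero]
      simp [funext_iff]
  simp only [Matrix.trace, Matrix.diag, Matrix.mul_apply]
  rw [hsum]
  refine Finset.sum_congr rfl fun x _ => ?_
  rw [Finset.sum_congr rfl fun s _ => hsum _, Finset.sum_comm]
  simp only [hprod]
  refine Finset.sum_congr rfl fun y _ => ?_
  simp only [marginal, Matrix.of_apply, Finset.mul_sum]
  refine Finset.sum_congr rfl fun s _ => ?_
  simp

end Reduction

/-! ### Parallel composition -/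

section Parallel

variable {ι : Type*} [DecidableEq ι] {κ : Type*} [Fintype κ] {S : Finset ι} {P : κ → Finset ι}
  (hP : ∀ ν, P ν ⊆ S)

omit [DecidableEq ι] [Fintype κ] in
lemma bijective_sigma_of_partition
    (hd : Pairwise fun μ ν => Disjoint (P μ) (P ν)) (hc : ∀ i ∈ S, ∃ ν, i ∈ P ν) :
    Function.Bijective fun a : Σ ν, {i // i ∈ P ν} =>
      (⟨a.2.1, hP a.1 a.2.2⟩ : {i // i ∈ S}) := by
  constructor
  · rintro ⟨μ, i, hi⟩ ⟨ν, j, hj⟩ h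
    have hij : i = j := congrArg Subtype.val h
    subst hij
    have : μ = ν := by
      by_contra hne
      exact Finset.disjoint_left.1 (hd hne) hi hj
    subst this
    rfl
  · rintro ⟨i, hi⟩
    obtain ⟨ν, hν⟩ := hc i hi
    exact ⟨⟨ν, i, hν⟩, rfl⟩

omit [DecidableEq ι] in
lemma prod_partition {M : Type*} [CommMonoid M]
    (hd : Pairwise fun μ ν => Disjoint (P μ) (P ν)) (hc : ∀ i ∈ S, ∃ ν, i ∈ P ν)
    (h : {i // i ∈ S} → M) :
    ∏ i, h i = ∏ ν, ∏ i : {i // i ∈ P ν}, h ⟨i.1, hP ν i.2⟩ := by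
  rw [← (bijective_sigma_of_partition hP hd hc).prod_comp h, Fintype.prod_sigma]

omit [DecidableEq ι] [Fintype κ] in
lemma bijective_restrict_of_partition {α : ι → Type*}
    (hd : Pairwise fun μ ν => Disjoint (P μ) (P ν)) (hc : ∀ i ∈ S, ∃ ν, i ∈ P ν) :
    Function.Bijective fun (u : ∀ i : {i // i ∈ S}, α i) (ν : κ) (i : {i // i ∈ P ν}) =>
      u ⟨i.1, hP ν i.2⟩ := by
  constructor
  · intro u u' h
    ext ⟨i, hi⟩
    obtain ⟨ν, hν⟩ := hc i hi
    exact congrFun (congrFun h ν) ⟨i, hν⟩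
  · intro w
    choose b hb using hc
    refine ⟨fun i => w (b i i.2) ⟨i, hb i i.2⟩, ?_⟩
    funext ν
    funext ⟨i, hi⟩
    have : ∀ μ (hμ : i ∈ P μ), w μ ⟨i, hμ⟩ = w ν ⟨i, hi⟩ := by
      intro μ hμ
      have : μ = ν := by
        by_contra hne
        exact Finset.disjoint_left.1 (hd hne) hμ hi
      subst this
      rfl
    exact this _ _

/-- A sum over configurations of a product over the blocks of a partition factorizes. -/
lemma sum_prod_partition {α : ι → Type*} [∀ i, Fintype (α i)] {M : Type*} [CommSemiring M]
    [DecidableEq κ]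
    (hd : Pairwise fun μ ν => Disjoint (P μ) (P ν)) (hc : ∀ i ∈ S, ∃ ν, i ∈ P ν)
    (f : ∀ ν, (∀ i : {i // i ∈ P ν}, α i) → M) :
    ∑ u : (∀ i : {i // i ∈ S}, α i), ∏ ν, f ν (fun i => u ⟨i.1, hP ν i.2⟩) =
      ∏ ν, ∑ w, f ν w := by
  rw [Fintype.prod_sum]
  exact (bijective_restrict_of_partition hP hd hc).sum_comp fun w => ∏ ν, f ν (w ν)

variable [Fintype ι] {ι' : Type*} [Fintype ι'] [DecidableEq ι'] {d : ι → ℕ} {d' : ι' → ℕ}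
  {T : Finset ι'} {Q : κ → Finset ι'} (hQ : ∀ ν, Q ν ⊆ T)

omit [Fintype ι] in
lemma parallel_single (Φ : ∀ ν, OpOn d (P ν) →ₗ[ℂ] OpOn d' (Q ν))
    (u v : ∀ i : {i // i ∈ S}, Fin (d i)) (x y : ∀ j : {j // j ∈ T}, Fin (d' j)) :
    parallel d d' S T P Q hP hQ Φ (Matrix.single u v 1) x y =
      ∏ ν, Φ ν (Matrix.single (fun i => u ⟨i.1, hP ν i.2⟩) (fun i => v ⟨i.1, hP ν i.2⟩) 1)
        (fun j => x ⟨j.1, hQ ν j.2⟩) (fun j => y ⟨j.1, hQ ν j.2⟩) := by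
  simp only [parallel, LinearMap.coe_mk, AddHom.coe_mk, Matrix.of_apply]
  rw [Finset.sum_eq_single u, Finset.sum_eq_single v]
  · simp
  · intro v' _ h
    simp [h.symm]
  · simp
  · intro u' _ h
    simp [h.symm]
  · simp

omit [Fintype ι] in
-- In matrix elements the summand is a product over the blocks, so each of the four index sums
-- factorizes along the partition.
lemma pairing_parallel [DecidableEq κ] (hdP : Pairwise fun μ ν => Disjoint (P μ) (P ν))
    (hcP : ∀ i ∈ S, ∃ ν, i ∈ P ν) (hdQ : Pairwise fun μ ν => Disjoint (Q μ) (Q ν))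
    (hcQ : ∀ j ∈ T, ∃ ν, j ∈ Q ν) (Φ : ∀ ν, OpOn d (P ν) →ₗ[ℂ] OpOn d' (Q ν))
    (Y : ∀ j : {j // j ∈ T}, Matrix (Fin (d' j)) (Fin (d' j)) ℂ)
    (X : ∀ i : {i // i ∈ S}, Matrix (Fin (d i)) (Fin (d i)) ℂ) :
    pairing (d := fun i : {i // i ∈ S} => d i) (d' := fun j : {j // j ∈ T} => d' j)
        (parallel d d' S T P Q hP hQ Φ) Y X =
      ∏ ν, pairing (d := fun i : {i // i ∈ P ν} => d i) (d' := fun j : {j // j ∈ Q ν} => d' j)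
        (Φ ν) (fun j => Y ⟨j.1, hQ ν j.2⟩) (fun i => X ⟨i.1, hP ν i.2⟩) := by
  simp only [pairing_eq_sum, parallel_single]
  rw [← sum_prod_partition hQ (α := fun j => Fin (d' j)) hdQ hcQ]
  refine Finset.sum_congr rfl fun y _ => ?_
  rw [← sum_prod_partition hQ (α := fun j => Fin (d' j)) hdQ hcQ]
  refine Finset.sum_congr rfl fun x _ => ?_
  rw [← sum_prod_partition hP (α := fun j => Fin (d j)) hdP hcP]
  refine Finset.sum_congr rfl fun u _ => ?_
  rw [← sum_prod_partition hP (α := fun j => Fin (d j)) hdP hcP]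
  refine Finset.sum_congr rfl fun v _ => ?_
  rw [prod_partition hQ hdQ hcQ, prod_partition hP hdP hcP]
  simp only [Finset.prod_mul_distrib]

end Parallel

/-! ### Positivity of the maps of an instrument -/

section CompletePositivity

variable {a b : Type*} [Fintype a] [Fintype b]

/-- The case of a one-dimensional ancilla. -/
lemma IsCompletelyPositive.map_posSemidef {Φ : Matrix a a ℂ →ₗ[ℂ] Matrix b b ℂ}
    (h : IsCompletelyPositive Φ) {X : Matrix a a ℂ} (hX : X.PosSemidef) : (Φ X).PosSemidef :=
  (h 1 (X.submatrix Prod.snd Prod.snd) (hX.submatrix _)).submatrix fun y : b => ((0 : Fin 1), y)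

/-- Both sides are conjugate-linear in `X` and agree on positive operators, which span. -/
lemma IsCompletelyPositive.map_conjTranspose [DecidableEq a]
    {Φ : Matrix a a ℂ →ₗ[ℂ] Matrix b b ℂ}
    (h : IsCompletelyPositive Φ) (X : Matrix a a ℂ) :
    Φ X.conjTranspose = (Φ X).conjTranspose := by
  have hX : X ∈ Submodule.span ℂ {A : Matrix a a ℂ | A.PosSemidef} := by
    rw [span_posSemidef]; trivial
  induction hX using Submodule.span_induction with
  | mem x hx =>
    have hx' : x.PosSemidef := hx
    rw [hx'.isHermitian.eq, (h.map_posSemidef hx').isHermitian.eq]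
  | zero => simp
  | add x y _ _ hx hy => simp [hx, hy]
  | smul c x _ hx => simp [hx]

/-- Since `Φ` commutes with the conjugate transpose, its sesquilinear adjoint is also its adjoint
for the bilinear form Tr[X Y]. -/
lemma trace_mul_hsAdjoint [DecidableEq a] {Φ : Matrix a a ℂ →ₗ[ℂ] Matrix b b ℂ}
    (h : IsCompletelyPositive Φ) (X : Matrix a a ℂ) (M : Matrix b b ℂ) :
    (X * hsAdjoint Φ M).trace = (M * Φ X).trace := by
  have h1 : Φ X = ∑ u, ∑ v, X u v • Φ (Matrix.single u v 1) := by
    conv_lhs => rw [Matrix.matrix_eq_sum_single X]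
    simp only [map_sum, ← map_smul, Matrix.smul_single, smul_eq_mul, mul_one]
  rw [h1, Matrix.mul_sum, Matrix.trace_sum]
  simp only [Matrix.mul_sum, Matrix.trace_sum, Matrix.mul_smul, Matrix.trace_smul]
  rw [Matrix.trace]
  simp only [Matrix.diag, Matrix.mul_apply, hsAdjoint, Matrix.of_apply, smul_eq_mul]
  refine Finset.sum_congr rfl fun u _ => Finset.sum_congr rfl fun v _ => ?_
  rw [← h.map_conjTranspose, Matrix.trace_mul_comm]
  simp

end CompletePositivity

/-! ### Slices of an instrument and the spaces they span -/

section Instrument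

variable {n m : ℕ} {dA : Fin n → ℕ} {dB : Fin m → ℕ} {C Z : Type*} [Fintype C]
  (I : MultiInstrument dA dB C Z)

lemma pairing_nonneg (c : C) (z : Z) {Y : ∀ j, Matrix (Fin (dB j)) (Fin (dB j)) ℂ}
    {X : ∀ i, Matrix (Fin (dA i)) (Fin (dA i)) ℂ} (hY : ∀ j, (Y j).PosSemidef)
    (hX : ∀ i, (X i).PosSemidef) : 0 ≤ pairing (I.map c z) Y X :=
  trace_mul_nonneg (tensor_posSemidef hY)
    ((I.completelyPositive c z).map_posSemidef (tensor_posSemidef hX))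

/-- The operator on the output `j` left over by a product state and effects on the other outputs. -/
def outputSlice (c : C) (z : Z) (j : Fin m) (ρ : ∀ i, Density (dA i)) (M : ∀ j, Effect (dB j)) :
    Matrix (Fin (dB j)) (Fin (dB j)) ℂ :=
  marginal dB j (tensor dB (Function.update (fun j' => (M j').1) j 1) *
    I.map c z (tensor dA fun i => (ρ i).1))

/-- The operator on the input `i` left over by a product effect and states on the other inputs. -/
def inputSlice (c : C) (z : Z) (i : Fin n) (ρ : ∀ i, Density (dA i)) (M : ∀ j, Effect (dB j)) :
    Matrix (Fin (dA i)) (Fin (dA i)) ℂ :=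
  marginal dA i (tensor dA (Function.update (fun i' => (ρ i').1) i 1) *
    hsAdjoint (I.map c z) (tensor dB fun j => (M j).1))

lemma update_one_mul_update {ι : Type*} [DecidableEq ι] {R : ι → Type*} [∀ i, MulOneClass (R i)]
    (x : ∀ i, R i) (i : ι) (y : R i) :
    (fun k => Function.update (fun _ => 1) i y k * Function.update x i 1 k) =
      Function.update x i y := by
  funext k
  by_cases hk : k = i
  · subst hk; simp
  · simp [hk]

/-- This turns traces against the generators of V into pairings with one free slot, the only way
slices are used below. -/
lemma trace_mul_outputSlice (c : C) (z : Z) (j : Fin m) (ρ : ∀ i, Density (dA i))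
    (M : ∀ j, Effect (dB j)) (Y : Matrix (Fin (dB j)) (Fin (dB j)) ℂ) :
    (Y * outputSlice I c z j ρ M).trace =
      pairing (I.map c z) (Function.update (fun j => (M j).1) j Y) fun i => (ρ i).1 := by
  rw [outputSlice, trace_mul_marginal, ← Matrix.mul_assoc, tensor_mul, update_one_mul_update,
    pairing]

lemma trace_mul_inputSlice (c : C) (z : Z) (i : Fin n) (ρ : ∀ i, Density (dA i))
    (M : ∀ j, Effect (dB j)) (X : Matrix (Fin (dA i)) (Fin (dA i)) ℂ) :
    (X * inputSlice I c z i ρ M).trace =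
      pairing (I.map c z) (fun j => (M j).1) (Function.update (fun i => (ρ i).1) i X) := by
  rw [inputSlice, trace_mul_marginal, ← Matrix.mul_assoc, tensor_mul, update_one_mul_update,
    trace_mul_hsAdjoint (I.completelyPositive c z), pairing]

lemma outputSlice_mem (c : C) (z : Z) (j : Fin m) (ρ : ∀ i, Density (dA i))
    (M : ∀ j, Effect (dB j)) : outputSlice I c z j ρ M ∈ I.outputSpace j :=
  Submodule.subset_span ⟨c, z, ρ, M, rfl⟩

lemma inputSlice_mem (c : C) (z : Z) (i : Fin n) (ρ : ∀ i, Density (dA i))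
    (M : ∀ j, Effect (dB j)) : inputSlice I c z i ρ M ∈ I.inputSpace i :=
  Submodule.subset_span ⟨c, z, ρ, M, rfl⟩

lemma outputSpace_eq (j : Fin m) : I.outputSpace j = Submodule.span ℝ (Set.range
    fun a : C × Z × (∀ i, Density (dA i)) × (∀ j, Effect (dB j)) =>
      outputSlice I a.1 a.2.1 j a.2.2.1 a.2.2.2) := by
  unfold MultiInstrument.outputSpace
  congr 1
  ext X
  constructor
  · rintro ⟨c, z, ρ, M, rfl⟩
    exact ⟨⟨c, z, ρ, M⟩, rfl⟩
  · rintro ⟨⟨c, z, ρ, M⟩, rfl⟩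
    exact ⟨c, z, ρ, M, rfl⟩

lemma inputSpace_eq (i : Fin n) : I.inputSpace i = Submodule.span ℝ (Set.range
    fun a : C × Z × (∀ i, Density (dA i)) × (∀ j, Effect (dB j)) =>
      inputSlice I a.1 a.2.1 i a.2.2.1 a.2.2.2) := by
  unfold MultiInstrument.inputSpace
  congr 1
  ext X
  constructor
  · rintro ⟨c, z, ρ, M, rfl⟩
    exact ⟨⟨c, z, ρ, M⟩, rfl⟩
  · rintro ⟨⟨c, z, ρ, M⟩, rfl⟩
    exact ⟨c, z, ρ, M, rfl⟩

lemma outputSlice_isHermitian (c : C) (z : Z) (j : Fin m) (ρ : ∀ i, Density (dA i))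
    (M : ∀ j, Effect (dB j)) : (outputSlice I c z j ρ M).IsHermitian := by
  refine isHermitian_of_trace_mul span_posSemidef (fun P hP => hP.isHermitian) fun P hP => ?_
  rw [trace_mul_outputSlice]
  refine (Complex.nonneg_iff.1 (pairing_nonneg I c z (fun k => ?_) fun i => (ρ i).2.1)).2.symm
  by_cases hk : k = j
  · subst hk; simpa using hP
  · simpa [hk] using (M k).2.1

lemma inputSlice_isHermitian (c : C) (z : Z) (i : Fin n) (ρ : ∀ i, Density (dA i))
    (M : ∀ j, Effect (dB j)) : (inputSlice I c z i ρ M).IsHermitian := by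
  refine isHermitian_of_trace_mul span_posSemidef (fun P hP => hP.isHermitian) fun P hP => ?_
  rw [trace_mul_inputSlice]
  refine (Complex.nonneg_iff.1 (pairing_nonneg I c z (fun j => (M j).2.1) fun k => ?_)).2.symm
  by_cases hk : k = i
  · subst hk; simpa using hP
  · simpa [hk] using (ρ k).2.1

lemma isHermitian_of_mem_outputSpace {j : Fin m} {X : Matrix (Fin (dB j)) (Fin (dB j)) ℂ}
    (hX : X ∈ I.outputSpace j) : X.IsHermitian := by
  rw [outputSpace_eq] at hX
  refine isHermitian_of_mem_span ?_ hX
  rintro _ ⟨a, rfl⟩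
  exact outputSlice_isHermitian ..

lemma isHermitian_of_mem_inputSpace {i : Fin n} {X : Matrix (Fin (dA i)) (Fin (dA i)) ℂ}
    (hX : X ∈ I.inputSpace i) : X.IsHermitian := by
  rw [inputSpace_eq] at hX
  refine isHermitian_of_mem_span ?_ hX
  rintro _ ⟨a, rfl⟩
  exact inputSlice_isHermitian ..

/-- The contraction with an instrument only depends on how the output operators pair with the
output spaces. -/
lemma pairing_congr_output (c : C) (z : Z) {Y Y' : ∀ j, Matrix (Fin (dB j)) (Fin (dB j)) ℂ}
    (X : ∀ i, Matrix (Fin (dA i)) (Fin (dA i)) ℂ)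
    (h : ∀ j, ∀ W ∈ I.outputSpace j, (W * (Y j - Y' j)).trace = 0) :
    pairing (I.map c z) Y X = pairing (I.map c z) Y' X := by
  -- One slot now holds `Y j - Y' j`. By spanning, the other outputs may be taken to be effects and
  -- the inputs states, which leaves a trace against a slice.
  refine multilinear_congr_of_update (pairingOut (I.map c z) X) Y Y' fun j W => ?_
  refine multilinear_update_eq_zero _ (fun j => Set.range fun M : Effect (dB j) => M.1)
    (fun j => span_effect) j ⟨_, Effect.unit _, rfl⟩ _ (fun y hy => ?_) W
  choose M hM using hy
  obtain rfl := funext hM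
  rw [pairingOut_apply, ← pairingIn_apply]
  refine multilinear_eq_zero_of_mem_span _ (fun i => Set.range fun ρ : Density (dA i) => ρ.1)
    (fun x hx => ?_) X fun i => by rw [span_density]; trivial
  choose ρ hρ using hx
  obtain rfl := funext hρ
  rw [pairingIn_apply, ← trace_mul_outputSlice, Matrix.trace_mul_comm]
  exact h j _ (outputSlice_mem I c z j ρ M)

/-- The contraction with an instrument only depends on how the input operators pair with the
input spaces. -/
lemma pairing_congr_input (hA : ∀ i, 0 < dA i) (c : C) (z : Z)
    (Y : ∀ j, Matrix (Fin (dB j)) (Fin (dB j)) ℂ)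
    {X X' : ∀ i, Matrix (Fin (dA i)) (Fin (dA i)) ℂ}
    (h : ∀ i, ∀ W ∈ I.inputSpace i, (W * (X i - X' i)).trace = 0) :
    pairing (I.map c z) Y X = pairing (I.map c z) Y X' := by
  refine multilinear_congr_of_update (pairingIn (I.map c z) Y) X X' fun i W => ?_
  refine multilinear_update_eq_zero _ (fun i => Set.range fun ρ : Density (dA i) => ρ.1)
    (fun i => span_density) i ?_ _ (fun x hx => ?_) W
  · obtain ⟨ρ⟩ := nonempty_density (hA i)
    exact ⟨_, ρ, rfl⟩
  choose ρ hρ using hx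
  obtain rfl := funext hρ
  rw [pairingIn_apply, ← pairingOut_apply]
  refine multilinear_eq_zero_of_mem_span _ (fun j => Set.range fun M : Effect (dB j) => M.1)
    (fun y hy => ?_) Y fun j => by rw [span_effect]; trivial
  choose M hM using hy
  obtain rfl := funext hM
  rw [pairingOut_apply, ← trace_mul_inputSlice, Matrix.trace_mul_comm]
  exact h i _ (inputSlice_mem I c z i ρ M)

/-! ### Pairings of effective processes and composites -/

lemma pairing_box (b : Box dA dB C Z)
    (Y : ∀ j : {j // j ∈ b.outputs}, Matrix (Fin (dB j)) (Fin (dB j)) ℂ)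
    (X : ∀ i : {i // i ∈ b.inputs}, Matrix (Fin (dA i)) (Fin (dA i)) ℂ) :
    pairing (d := fun i : {i // i ∈ b.inputs} => dA i)
        (d' := fun j : {j // j ∈ b.outputs} => dB j) (b.process I) Y X =
      pairing (I.map b.c b.z) (glue b.outputs Y fun j => (b.effect j).1)
        (glue b.inputs X fun i => (b.state i).1) := by
  simp only [pairing, Box.process, LinearMap.comp_apply, trace_tensor_mul_partialTrace,
    insertOps_tensor, LinearMap.mulLeft_apply, ← Matrix.mul_assoc, tensor_mul]
  congr 4
  funext j
  by_cases hj : j ∈ b.outputs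
  · simp [glue_of_mem _ _ _ hj, hj]
  · simp [glue_of_notMem _ _ _ hj, hj]

lemma pairing_composite {S : Finset (Fin n)} {T : Finset (Fin m)} (D : Composite dA dB C Z S T)
    (Y : ∀ j : {j // j ∈ T}, Matrix (Fin (dB j)) (Fin (dB j)) ℂ)
    (X : ∀ i : {i // i ∈ S}, Matrix (Fin (dA i)) (Fin (dA i)) ℂ) :
    pairing (d := fun i : {i // i ∈ S} => dA i) (d' := fun j : {j // j ∈ T} => dB j)
        (D.process I) Y X =
      ∏ ν, pairing (I.map (D.box ν).c (D.box ν).z)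
        (glue (D.box ν).outputs (fun j => Y ⟨j.1, (D.outputs_union j.1).2 ⟨ν, j.2⟩⟩)
          fun j => ((D.box ν).effect j).1)
        (glue (D.box ν).inputs (fun i => X ⟨i.1, (D.inputs_union i.1).2 ⟨ν, i.2⟩⟩)
          fun i => ((D.box ν).state i).1) := by
  rw [Composite.process, pairing_parallel _ _ D.inputs_disjoint
    (fun i hi => (D.inputs_union i).1 hi) D.outputs_disjoint
    (fun j hj => (D.outputs_union j).1 hj)]
  exact Finset.prod_congr rfl fun ν _ => pairing_box I _ _ _

end Instrument

/-! ### Expanding multilinear forms slot by slot -/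

section Expansion

variable {ι : Type*} [Fintype ι] [DecidableEq ι] {E : ι → Type*} [∀ i, AddCommGroup (E i)]
  [∀ i, Module ℂ (E i)] {k : ι → ℕ}

lemma multilinear_sum_smul (f : MultilinearMap ℂ E ℂ) (e : ∀ i, Fin (k i) → E i)
    (a : ∀ i, Fin (k i) → ℂ) :
    f (fun i => ∑ l, a i l • e i l) =
      ∑ l : (∀ i, Fin (k i)), (∏ i, a i (l i)) * f fun i => e i (l i) := by
  rw [f.map_sum]
  exact Finset.sum_congr rfl fun l _ => f.map_smul_univ _ _

lemma multilinear_glue_sum_smul (f : MultilinearMap ℂ E ℂ) (e : ∀ i, Fin (k i) → E i)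
    (T : Finset ι) (l : ∀ i : {i // i ∈ T}, Fin (k i)) (a : ∀ i : {i // ¬ i ∈ T}, Fin (k i) → ℂ) :
    f (glue T (fun i => e i (l i)) fun i => ∑ x, a i x • e i x) =
      ∑ s : (∀ i : {i // ¬ i ∈ T}, Fin (k i)),
        (∏ i, a i (s i)) * f fun i => e i (glue (α := fun i => Fin (k i)) T l s i) := by
  -- The slots in `T` are also written as sums, with Kronecker delta coefficients at `l`; in the
  -- full expansion only the configurations extending `l` survive.
  have h : glue T (fun i => e i (l i)) (fun i => ∑ x, a i x • e i x) =
      fun i => ∑ x, glue (α := fun i => Fin (k i) → ℂ) T (fun i => Pi.single (l i) 1) a i x •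
        e i x := by
    funext i
    by_cases hi : i ∈ T
    · simp [glue_of_mem _ _ _ hi, Pi.single_apply]
    · simp [glue_of_notMem _ _ _ hi]
  rw [h, multilinear_sum_smul, sum_glue T, Finset.sum_eq_single l]
  · refine Finset.sum_congr rfl fun s _ => ?_
    rw [prod_mul_prod_notMem T]
    simp
  · intro l' _ hl
    refine Finset.sum_eq_zero fun s _ => ?_
    obtain ⟨i, hi⟩ := Function.ne_iff.1 hl
    rw [Finset.prod_eq_zero (Finset.mem_univ i.1), zero_mul]
    simp [hi]
  · simp

end Expansion

/-! ### Frame expansions modulo the orthogonal complement -/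

section Frames

variable {d k : ℕ} {V : Submodule ℝ (Matrix (Fin d) (Fin d) ℂ)}
  {E D : Fin k → Matrix (Fin d) (Fin d) ℂ}

lemma IsFrameWithDual.symm (h : IsFrameWithDual V E D) : IsFrameWithDual V D E :=
  ⟨h.dual_hermitian, h.frame_hermitian, h.reconstruct_dual, h.reconstruct⟩

/-- `Y` is arbitrary here, so its expansion need not return it. Reconstructing the test operator `W`
instead shows that the error is invisible to `V`, which is all that pairings require. -/
lemma IsFrameWithDual.trace_mul_sub (h : IsFrameWithDual V E D) (Y : Matrix (Fin d) (Fin d) ℂ)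
    {W : Matrix (Fin d) (Fin d) ℂ} (hW : W ∈ V) :
    (W * (Y - ∑ l, (Y * E l).trace • D l)).trace = 0 := by
  have h1 : (W * Y).trace = ∑ l, (W * D l).trace * (E l * Y).trace := by
    conv_lhs => rw [h.reconstruct W hW]
    simp [Finset.sum_mul, Matrix.trace_sum]
  rw [Matrix.mul_sub, Matrix.trace_sub, h1, Matrix.mul_sum, Matrix.trace_sum, sub_eq_zero]
  refine Finset.sum_congr rfl fun l _ => ?_
  rw [Matrix.mul_smul, Matrix.trace_smul, smul_eq_mul, Matrix.trace_mul_comm (E l), mul_comm]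

end Frames

/-! ### From a product frame representation to an ontological model -/

section FrameToModel

variable {n m : ℕ} {dA : Fin n → ℕ} {dB : Fin m → ℕ} {C Z : Type*} [Fintype C]
  (I : MultiInstrument dA dB C Z) {kA : Fin n → ℕ} {kB : Fin m → ℕ}

/-- The ontic map given by a product frame representation. -/
noncomputable def frameModel
    (σ H : ∀ j, Fin (kB j) → Matrix (Fin (dB j)) (Fin (dB j)) ℂ)
    (F G : ∀ i, Fin (kA i) → Matrix (Fin (dA i)) (Fin (dA i)) ℂ) :
    OnticMap dA dB C Z (fun i => Fin (kA i)) (fun j => Fin (kB j)) where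
  prep i ρ l := (ρ.1 * G i l).trace.re
  resp j M l := (M.1 * σ j l).trace.re
  trans c z lB lA := (pairing (I.map c z) (fun j => H j (lB j)) fun i => F i (lA i)).re

variable {I}
  {σ H : ∀ j, Fin (kB j) → Matrix (Fin (dB j)) (Fin (dB j)) ℂ}
  {F G : ∀ i, Fin (kA i) → Matrix (Fin (dA i)) (Fin (dA i)) ℂ}

namespace IsFrameRepresentation

lemma ofReal_prep (h : IsFrameRepresentation I σ H F G) (i : Fin n) (ρ : Density (dA i))
    (l : Fin (kA i)) : ((frameModel I σ H F G).prep i ρ l : ℂ) = (ρ.1 * G i l).trace :=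
  ofReal_re_trace_mul ρ.2.1.isHermitian (h.input_povm i l).isHermitian

lemma ofReal_resp (h : IsFrameRepresentation I σ H F G) (j : Fin m) (M : Effect (dB j))
    (l : Fin (kB j)) : ((frameModel I σ H F G).resp j M l : ℂ) = (M.1 * σ j l).trace :=
  ofReal_re_trace_mul M.2.1.isHermitian (h.output_density j l).1.isHermitian

lemma ofReal_trans (h : IsFrameRepresentation I σ H F G) (c : C) (z : Z)
    (lB : ∀ j, Fin (kB j)) (lA : ∀ i, Fin (kA i)) :
    ((frameModel I σ H F G).trans c z lB lA : ℂ) =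
      pairing (I.map c z) (fun j => H j (lB j)) fun i => F i (lA i) :=
  Complex.conj_eq_iff_re.1 (Complex.conj_eq_iff_im.2
    (Complex.nonneg_iff.1 (h.coeff_nonneg c z lA lB)).2.symm)

/-- Replacing the closed effects and states by their frame expansions does not change the pairing,
and multilinear expansion then yields the sum over closed ontic states. The right side depends on
the box only through its process. -/
lemma ofReal_box (h : IsFrameRepresentation I σ H F G) (hA : ∀ i, 0 < dA i) (b : Box dA dB C Z)
    (lB : ∀ j : {j // j ∈ b.outputs}, Fin (kB j)) (lA : ∀ i : {i // i ∈ b.inputs}, Fin (kA i)) :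
    ((frameModel I σ H F G).box b lB lA : ℂ) =
      pairing (I.map b.c b.z) (glue b.outputs (fun j => H j (lB j)) fun j => (b.effect j).1)
        (glue b.inputs (fun i => F i (lA i)) fun i => (b.state i).1) := by
  rw [pairing_congr_output I b.c b.z (Y' := glue b.outputs (fun j => H j (lB j))
      fun j => ∑ l, ((b.effect j).1 * σ j l).trace • H j l),
    pairing_congr_input I hA b.c b.z (X' := glue b.inputs (fun i => F i (lA i))
      fun i => ∑ l, ((b.state i).1 * G i l).trace • F i l),
    ← pairingOut_apply, multilinear_glue_sum_smul]
  · simp only [pairingOut_apply]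
    rw [OnticMap.box]
    push_cast
    refine Finset.sum_congr rfl fun sB _ => ?_
    rw [← pairingIn_apply, multilinear_glue_sum_smul, Finset.mul_sum]
    refine Finset.sum_congr rfl fun sA _ => ?_
    simp only [pairingIn_apply, h.ofReal_prep, h.ofReal_resp, h.ofReal_trans]
    ring
  · intro i W hW
    by_cases hi : i ∈ b.inputs
    · simp [glue_of_mem _ _ _ hi]
    · simp only [glue_of_notMem _ _ _ hi]
      exact (h.input_frame i).symm.trace_mul_sub _ hW
  · intro j W hW
    by_cases hj : j ∈ b.outputs
    · simp [glue_of_mem _ _ _ hj]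
    · simp only [glue_of_notMem _ _ _ hj]
      exact (h.output_frame j).trace_mul_sub _ hW

lemma ofReal_composite (h : IsFrameRepresentation I σ H F G) (hA : ∀ i, 0 < dA i)
    {S : Finset (Fin n)} {T : Finset (Fin m)} (D : Composite dA dB C Z S T)
    (lB : ∀ j : {j // j ∈ T}, Fin (kB j)) (lA : ∀ i : {i // i ∈ S}, Fin (kA i)) :
    ((frameModel I σ H F G).composite D lB lA : ℂ) =
      pairing (d := fun i : {i // i ∈ S} => dA i) (d' := fun j : {j // j ∈ T} => dB j)
        (D.process I) (fun j => H j (lB j)) fun i => F i (lA i) := by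
  rw [OnticMap.composite, pairing_composite]
  push_cast
  exact Finset.prod_congr rfl fun ν _ => h.ofReal_box hA _ _ _

theorem isOntologicalModel (h : IsFrameRepresentation I σ H F G) (hA : ∀ i, 0 < dA i) :
    IsOntologicalModel I (frameModel I σ H F G) where
  prep_nonneg i ρ l := (Complex.nonneg_iff.1 (trace_mul_nonneg ρ.2.1 (h.input_povm i l))).1
  prep_sum i ρ := by
    have : ((∑ l, (frameModel I σ H F G).prep i ρ l : ℝ) : ℂ) = 1 := by
      push_cast
      simp only [h.ofReal_prep]
      rw [← Matrix.trace_sum, ← Matrix.mul_sum, (h.input_dual_sum i).2, Matrix.mul_one, ρ.2.2]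
    exact_mod_cast this
  resp_nonneg j M l :=
    (Complex.nonneg_iff.1 (trace_mul_nonneg M.2.1 (h.output_density j l).1)).1
  resp_sum j k M hM l := by
    have : ((∑ b, (frameModel I σ H F G).resp j (M b) l : ℝ) : ℂ) = 1 := by
      push_cast
      simp only [h.ofReal_resp]
      rw [← Matrix.trace_sum, ← Finset.sum_mul, hM, Matrix.one_mul, (h.output_density j l).2]
    exact_mod_cast this
  trans_nonneg c z lB lA := (Complex.nonneg_iff.1 (h.coeff_nonneg c z lA lB)).1
  trans_sum z lA := by
    have h1 : ∀ c, ∑ lB : (∀ j, Fin (kB j)), pairing (I.map c z) (fun j => H j (lB j))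
        (fun i => F i (lA i)) = (I.map c z (tensor dA fun i => F i (lA i))).trace := by
      intro c
      have h2 := (pairingOut (I.map c z) fun i => F i (lA i)).map_sum fun j l => H j l
      simp only [pairingOut_apply] at h2
      -- The dual operators sum to the projection of 1 onto V, so their sum may be replaced by 1 in
      -- every output slot.
      rw [← h2, ← pairing_congr_output I c z (Y := fun _ => 1), pairing, tensor_one,
        Matrix.one_mul]
      exact fun j W hW => (h.output_dual_sum j).2 W hW
    have : ((∑ c, ∑ lB, (frameModel I σ H F G).trans c z lB lA : ℝ) : ℂ) = 1 := by
      push_cast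
      simp only [h.ofReal_trans, h1]
      rw [← Matrix.trace_sum, I.tracePreserving, trace_tensor]
      simp [h.input_trace]
    exact_mod_cast this
  adequate c z ρ M := by
    change pairing (I.map c z) (fun j => (M j).1) (fun i => (ρ i).1) = _
    rw [pairing_congr_output I c z (Y' := fun j => ∑ l, ((M j).1 * σ j l).trace • H j l)
        _ fun j W hW => (h.output_frame j).trace_mul_sub _ hW,
      pairing_congr_input I hA c z (X' := fun i => ∑ l, ((ρ i).1 * G i l).trace • F i l)
        _ fun i W hW => (h.input_frame i).symm.trace_mul_sub _ hW,
      ← pairingOut_apply, multilinear_sum_smul]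
    push_cast
    refine Finset.sum_congr rfl fun lB _ => ?_
    rw [pairingOut_apply, ← pairingIn_apply, multilinear_sum_smul, Finset.mul_sum]
    refine Finset.sum_congr rfl fun lA _ => ?_
    rw [pairingIn_apply]
    simp only [h.ofReal_prep, h.ofReal_resp, h.ofReal_trans]
    ring
  prep_linear i k ρ α hα l := by
    have h1 := congrArg (fun X => (X * G i l).trace.re) hα
    simpa [Finset.sum_mul, Matrix.trace_sum, frameModel] using h1
  resp_linear j k M α hα l := by
    have h1 := congrArg (fun X => (X * σ j l).trace.re) hα
    simpa [Finset.sum_mul, Matrix.trace_sum, frameModel] using h1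
  composite_linear S T k D α hα lB lA := by
    have h1 := pairing_sum_smul (d := fun i : {i // i ∈ S} => dA i)
      (d' := fun j : {j // j ∈ T} => dB j) (fun x => (α x : ℂ)) (fun x => (D x).process I)
      (fun j => H j (lB j)) (fun i => F i (lA i))
    -- The representation of a composite is a fixed linear functional of its process, so operational
    -- identities carry over.
    simp only [← h.ofReal_composite hA] at h1
    have h2 : ((∑ x, α x * (frameModel I σ H F G).composite (D x) lB lA : ℝ) : ℂ) = 0 := by
      push_cast
      rw [← h1]
      erw [hα]
      simp [pairing]
    exact_mod_cast h2

end IsFrameRepresentation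

end FrameToModel

/-! ### Dual frames from a single reconstruction formula -/

section DualFrames

variable {d k : ℕ} {V : Submodule ℝ (Matrix (Fin d) (Fin d) ℂ)}
  {E D : Fin k → Matrix (Fin d) (Fin d) ℂ}

lemma ofReal_smul_matrix {a b : Type*} (r : ℝ) (X : Matrix a b ℂ) : (r : ℂ) • X = r • X := by
  ext
  simp

/-- If the dual operators lie in the space, one reconstruction formula implies the other. -/
lemma isFrameWithDual_of_reconstruct (hV : ∀ X ∈ V, X.IsHermitian) (hE : ∀ l, (E l).IsHermitian)
    (hD : ∀ l, D l ∈ V) (h : ∀ X ∈ V, X = ∑ l, (X * D l).trace • E l) :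
    IsFrameWithDual V E D := by
  refine ⟨hE, fun l => hV _ (hD l), h, fun X hX => ?_⟩
  -- The defect is orthogonal to V by the first formula and lies in V because the `D l` do, so it
  -- vanishes.
  set Δ := X - ∑ l, (X * E l).trace • D l with hΔ
  have hmem : Δ ∈ V := by
    refine V.sub_mem hX (V.sum_mem fun l _ => ?_)
    rw [← ofReal_re_trace_mul (hV X hX) (hE l), ofReal_smul_matrix]
    exact V.smul_mem _ (hD l)
  have horth : (Δ * Δ).trace = 0 := by
    have h1 : (Δ * X).trace = ∑ l, (Δ * D l).trace * (E l * X).trace := by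
      conv_lhs => rw [h Δ hmem]
      simp [Finset.sum_mul, Matrix.trace_sum]
    have h2 : (Δ * Δ).trace = (Δ * (X - ∑ l, (X * E l).trace • D l)).trace := by rw [← hΔ]
    rw [h2, Matrix.mul_sub, Matrix.trace_sub, h1, Matrix.mul_sum, Matrix.trace_sum, sub_eq_zero]
    refine Finset.sum_congr rfl fun l _ => ?_
    rw [Matrix.mul_smul, Matrix.trace_smul, smul_eq_mul, Matrix.trace_mul_comm (E l), mul_comm]
  have h0 : Δ = 0 := by
    refine Matrix.trace_conjTranspose_mul_self_eq_zero_iff.1 ?_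
    rw [(hV _ hmem).eq, horth]
  exact sub_eq_zero.1 h0

lemma reconstruct_of_span {ι : Type*} (g : ι → Matrix (Fin d) (Fin d) ℂ)
    (h : ∀ a, g a = ∑ l, (g a * D l).trace • E l) :
    ∀ X ∈ Submodule.span ℝ (Set.range g), X = ∑ l, (X * D l).trace • E l := by
  intro X hX
  induction hX using Submodule.span_induction with
  | mem x hx => obtain ⟨a, rfl⟩ := hx; exact h a
  | zero => simp
  | add x y _ _ hx hy =>
    simp only [add_mul, Matrix.trace_add, add_smul, Finset.sum_add_distrib]
    rw [← hx, ← hy]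
  | smul c x _ hx =>
    simp only [Matrix.smul_mul, Matrix.trace_smul, smul_assoc, ← Finset.smul_sum]
    rw [← hx]

end DualFrames

/-! ### Configurations on one system or on none -/

section SingletonGlue

variable {ι : Type*} [Fintype ι] [DecidableEq ι] {α : ι → Type*}

omit [Fintype ι] in
lemma glue_singleton (j : ι) (x : ∀ i : {i // i ∈ ({j} : Finset ι)}, α i) (y : ∀ i, α i) :
    glue {j} x (fun i => y i) = Function.update y j (x ⟨j, Finset.mem_singleton_self j⟩) := by
  funext i
  by_cases h : i = j
  · subst h
    rw [glue_of_mem _ _ _ (Finset.mem_singleton_self i), Function.update_self]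
  · rw [glue_of_notMem _ _ _ (by simpa using h), Function.update_of_ne h]

omit [Fintype ι] in
lemma glue_empty (x : ∀ i : {i // i ∈ (∅ : Finset ι)}, α i) (y : ∀ i, α i) :
    glue ∅ x (fun i => y i) = y := by
  funext i
  rw [glue_of_notMem _ _ _ (Finset.notMem_empty i)]

lemma glue_univ (x : ∀ i, α i) (y : ∀ i : {i // ¬ i ∈ (Finset.univ : Finset ι)}, α i) :
    glue Finset.univ (fun i => x i) y = x := by
  funext i
  rw [glue_of_mem _ _ _ (Finset.mem_univ i)]

/-- A value on one system as a configuration of the group consisting of that system. -/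
def atSingle {j : ι} (l : α j) (i : {i // i ∈ ({j} : Finset ι)}) : α i :=
  (Finset.mem_singleton.1 i.2).symm ▸ l

omit [Fintype ι] [DecidableEq ι] in
@[simp] lemma atSingle_self {j : ι} (l : α j) :
    atSingle l ⟨j, Finset.mem_singleton_self j⟩ = l := rfl

omit [Fintype ι] [DecidableEq ι] in
lemma eq_atSingle {j : ι} (x : ∀ i : {i // i ∈ ({j} : Finset ι)}, α i) :
    x = atSingle (x ⟨j, Finset.mem_singleton_self j⟩) := by
  funext ⟨i, hi⟩
  obtain rfl := Finset.mem_singleton.1 hi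
  rfl

omit [Fintype ι] in
lemma sum_atSingle [∀ i, Fintype (α i)] {M : Type*} [AddCommMonoid M] (j : ι)
    (f : (∀ i : {i // i ∈ ({j} : Finset ι)}, α i) → M) : ∑ x, f x = ∑ l : α j, f (atSingle l) := by
  refine (Function.Bijective.sum_comp (e := fun l : α j => atSingle l) ⟨fun l l' h => ?_,
    fun x => ⟨_, (eq_atSingle x).symm⟩⟩ f).symm
  exact congrFun h ⟨j, Finset.mem_singleton_self j⟩

/-- The configuration of the empty group. -/
def atEmpty (α : ι → Type*) (i : {i // i ∈ (∅ : Finset ι)}) : α i :=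
  absurd i.2 (Finset.notMem_empty i.1)

omit [Fintype ι] [DecidableEq ι] in
lemma eq_atEmpty (x : ∀ i : {i // i ∈ (∅ : Finset ι)}, α i) : x = atEmpty α := by
  funext i
  exact absurd i.2 (Finset.notMem_empty i.1)

omit [Fintype ι] in
lemma sum_atEmpty [∀ i, Fintype (α i)] {M : Type*} [AddCommMonoid M]
    (f : (∀ i : {i // i ∈ (∅ : Finset ι)}, α i) → M) : ∑ x, f x = f (atEmpty α) := by
  rw [Finset.sum_eq_single (atEmpty α)]
  · exact fun x _ h => absurd (eq_atEmpty x) h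
  · exact fun h => absurd (Finset.mem_univ _) h

omit [Fintype ι] [DecidableEq ι] in
lemma prod_single {M : Type*} [CommMonoid M] (j : ι)
    (f : {i // i ∈ ({j} : Finset ι)} → M) :
    ∏ i, f i = f ⟨j, Finset.mem_singleton_self j⟩ :=
  Fintype.prod_eq_single _ fun i hi =>
    absurd (Subtype.ext (Finset.mem_singleton.1 i.2)) hi

omit [Fintype ι] [DecidableEq ι] in
lemma prod_empty {M : Type*} [CommMonoid M] (f : {i // i ∈ (∅ : Finset ι)} → M) :
    ∏ i, f i = 1 :=
  Finset.prod_eq_one fun i _ => absurd i.2 (Finset.notMem_empty i.1)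

end SingletonGlue

/-! ### Operators extracted from an ontological model -/

section ModelToFrame

variable {n m : ℕ} {dA : Fin n → ℕ} {dB : Fin m → ℕ} {C Z : Type*} [Fintype C]

/-- Outcome, setting, local states and local effects. -/
abbrev Contraction (dA : Fin n → ℕ) (dB : Fin m → ℕ) (C Z : Type*) : Type _ :=
  C × Z × (∀ i, Density (dA i)) × (∀ j, Effect (dB j))

/-- The box with given open systems. -/
def Contraction.box (a : Contraction dA dB C Z) (S : Finset (Fin n)) (T : Finset (Fin m)) :
    Box dA dB C Z :=
  ⟨a.1, a.2.1, S, T, a.2.2.1, a.2.2.2⟩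

/-- A single box as a composite. -/
def Contraction.composite (a : Contraction dA dB C Z) (S : Finset (Fin n)) (T : Finset (Fin m)) :
    Composite dA dB C Z S T where
  k := 1
  box _ := a.box S T
  inputs_disjoint _ _ h := absurd (Subsingleton.elim _ _) h
  outputs_disjoint _ _ h := absurd (Subsingleton.elim _ _) h
  inputs_union _ := ⟨fun h => ⟨0, h⟩, fun ⟨_, h⟩ => h⟩
  outputs_union _ := ⟨fun h => ⟨0, h⟩, fun ⟨_, h⟩ => h⟩

variable (I : MultiInstrument dA dB C Z)

lemma pairing_contraction_composite (a : Contraction dA dB C Z) (S : Finset (Fin n))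
    (T : Finset (Fin m)) (Y : ∀ j : {j // j ∈ T}, Matrix (Fin (dB j)) (Fin (dB j)) ℂ)
    (X : ∀ i : {i // i ∈ S}, Matrix (Fin (dA i)) (Fin (dA i)) ℂ) :
    pairing (d := fun i : {i // i ∈ S} => dA i) (d' := fun j : {j // j ∈ T} => dB j)
        ((a.composite S T).process I) Y X =
      pairing (I.map a.1 a.2.1) (glue T Y fun j => (a.2.2.2 j).1)
        (glue S X fun i => (a.2.2.1 i).1) := by
  rw [pairing_composite]
  exact Fin.prod_univ_one _

variable {I} {ΛA : Fin n → Type} {ΛB : Fin m → Type} [∀ i, Fintype (ΛA i)] [∀ j, Fintype (ΛB j)]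
  {p : OnticMap dA dB C Z ΛA ΛB}

omit [Fintype C] in
lemma OnticMap.composite_contraction (a : Contraction dA dB C Z) (S : Finset (Fin n))
    (T : Finset (Fin m)) (lB : ∀ j : {j // j ∈ T}, ΛB j) (lA : ∀ i : {i // i ∈ S}, ΛA i) :
    p.composite (a.composite S T) lB lA = p.box (a.box S T) lB lA :=
  Fin.prod_univ_one _

omit [Fintype C] in
lemma OnticMap.box_contraction (a : Contraction dA dB C Z) (S : Finset (Fin n))
    (T : Finset (Fin m)) (lB : ∀ j : {j // j ∈ T}, ΛB j) (lA : ∀ i : {i // i ∈ S}, ΛA i) :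
    p.box (a.box S T) lB lA = ∑ sB : (∀ j : {j // ¬ j ∈ T}, ΛB j),
      ∑ sA : (∀ i : {i // ¬ i ∈ S}, ΛA i), p.trans a.1 a.2.1 (glue T lB sB) (glue S lA sA) *
        (∏ j : {j // ¬ j ∈ T}, p.resp j (a.2.2.2 j) (sB j)) *
        ∏ i : {i // ¬ i ∈ S}, p.prep i (a.2.2.1 i) (sA i) := rfl

namespace IsOntologicalModel

/-- Operational identities can be checked on product tests, since these separate linear maps. -/
lemma composite_linear_of_pairing (h : IsOntologicalModel I p) {S : Finset (Fin n)}
    {T : Finset (Fin m)} {k : ℕ} (D : Fin k → Composite dA dB C Z S T) (α : Fin k → ℝ)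
    (hα : ∀ (Y : ∀ j : {j // j ∈ T}, Matrix (Fin (dB j)) (Fin (dB j)) ℂ)
      (X : ∀ i : {i // i ∈ S}, Matrix (Fin (dA i)) (Fin (dA i)) ℂ),
      ∑ x, (α x : ℂ) * pairing (d := fun i : {i // i ∈ S} => dA i)
        (d' := fun j : {j // j ∈ T} => dB j) ((D x).process I) Y X = 0)
    (lB : ∀ j : {j // j ∈ T}, ΛB j) (lA : ∀ i : {i // i ∈ S}, ΛA i) :
    ∑ x, α x * p.composite (D x) lB lA = 0 := by
  refine h.composite_linear S T k D α ?_ lB lA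
  refine eq_of_pairing_eq (d := fun i : {i // i ∈ S} => dA i)
    (d' := fun j : {j // j ∈ T} => dB j) fun Y X => ?_
  refine (pairing_sum_smul (d := fun i : {i // i ∈ S} => dA i)
    (d' := fun j : {j // j ∈ T} => dB j) _ _ Y X).trans ?_
  rw [hα]
  simp [pairing]

lemma box_linear (h : IsOntologicalModel I p) {S : Finset (Fin n)}
    {T : Finset (Fin m)} {k : ℕ} (a : Fin k → Contraction dA dB C Z) (α : Fin k → ℝ)
    (hα : ∀ (Y : ∀ j : {j // j ∈ T}, Matrix (Fin (dB j)) (Fin (dB j)) ℂ)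
      (X : ∀ i : {i // i ∈ S}, Matrix (Fin (dA i)) (Fin (dA i)) ℂ),
      ∑ x, (α x : ℂ) * pairing (I.map (a x).1 (a x).2.1) (glue T Y fun j => ((a x).2.2.2 j).1)
        (glue S X fun i => ((a x).2.2.1 i).1) = 0)
    (lB : ∀ j : {j // j ∈ T}, ΛB j) (lA : ∀ i : {i // i ∈ S}, ΛA i) :
    ∑ x, α x * p.box ((a x).box S T) lB lA = 0 := by
  simp only [← OnticMap.composite_contraction]
  refine h.composite_linear_of_pairing _ α (fun Y X => ?_) lB lA
  simp only [pairing_contraction_composite]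
  exact hα Y X

/-- Closing the open systems of a box reproduces the quantum statistics. -/
lemma sum_box (h : IsOntologicalModel I p) (a : Contraction dA dB C Z) (S : Finset (Fin n))
    (T : Finset (Fin m)) (M : ∀ j : {j // j ∈ T}, Effect (dB j))
    (ρ : ∀ i : {i // i ∈ S}, Density (dA i)) :
    ((∑ lB : (∀ j : {j // j ∈ T}, ΛB j), ∑ lA : (∀ i : {i // i ∈ S}, ΛA i),
      p.box (a.box S T) lB lA *
      (∏ j : {j // j ∈ T}, p.resp j (M j) (lB j)) *
      ∏ i : {i // i ∈ S}, p.prep i (ρ i) (lA i) : ℝ) : ℂ) =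
      pairing (I.map a.1 a.2.1) (glue T (fun j => (M j).1) fun j => (a.2.2.2 j).1)
        (glue S (fun i => (ρ i).1) fun i => (a.2.2.1 i).1) := by
  have h1 := h.adequate a.1 a.2.1 (glue (α := fun i => Density (dA i)) S ρ fun i => a.2.2.1 i)
    (glue (α := fun j => Effect (dB j)) T M fun j => a.2.2.2 j)
  have hB : (fun j => (glue (α := fun j => Effect (dB j)) T M (fun j => a.2.2.2 j) j).1) =
      glue T (fun j => (M j).1) fun j => (a.2.2.2 j).1 := by
    funext j
    by_cases hj : j ∈ T
    · simp only [glue_of_mem _ _ _ hj]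
    · simp only [glue_of_notMem _ _ _ hj]
  have hA : (fun i => (glue (α := fun i => Density (dA i)) S ρ (fun i => a.2.2.1 i) i).1) =
      glue S (fun i => (ρ i).1) fun i => (a.2.2.1 i).1 := by
    funext i
    by_cases hi : i ∈ S
    · simp only [glue_of_mem _ _ _ hi]
    · simp only [glue_of_notMem _ _ _ hi]
  rw [hA, hB] at h1
  rw [pairing, h1]
  congr 1
  rw [sum_glue T]
  refine Finset.sum_congr rfl fun lB _ => ?_
  rw [Finset.sum_congr rfl fun sB _ => sum_glue S (α := ΛA) _, Finset.sum_comm]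
  refine Finset.sum_congr rfl fun lA _ => ?_
  rw [OnticMap.box_contraction, Finset.sum_mul, Finset.sum_mul]
  refine Finset.sum_congr rfl fun sB _ => ?_
  rw [Finset.sum_mul, Finset.sum_mul]
  refine Finset.sum_congr rfl fun sA _ => ?_
  rw [prod_mul_prod_notMem T, prod_mul_prod_notMem S]
  simp only [glue_coe, glue_coe']
  ring

lemma resp_unit (h : IsOntologicalModel I p) (j : Fin m) (l : ΛB j) :
    p.resp j (Effect.unit _) l = 1 := by
  have := h.resp_sum j 1 (fun _ => Effect.unit _) (by simp [Effect.unit]) l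
  simpa using this

/-- Discarding all outputs and the outcome leaves the constant function. -/
lemma sum_box_discard (h : IsOntologicalModel I p) (z : Z) (ρ : ∀ i, Density (dA i))
    (S : Finset (Fin n)) (lA : ∀ i : {i // i ∈ S}, ΛA i) :
    ∑ c, p.box (Contraction.box (dB := dB) (c, z, ρ, fun j => Effect.unit (dB j)) S ∅)
      (atEmpty ΛB) lA = 1 := by
  have h1 : ∀ sA : (∀ i : {i // ¬ i ∈ S}, ΛA i),
      ∑ c, ∑ sB : (∀ j : {j // ¬ j ∈ (∅ : Finset (Fin m))}, ΛB j),
        p.trans c z (glue ∅ (atEmpty ΛB) sB) (glue S lA sA) = 1 := by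
    intro sA
    rw [← h.trans_sum z (glue S lA sA)]
    refine Finset.sum_congr rfl fun c _ => ?_
    rw [sum_glue ∅ (fun lB => p.trans c z lB (glue S lA sA)), sum_atEmpty]
  have h2 : ∀ c, p.box (Contraction.box (dB := dB) (c, z, ρ, fun j => Effect.unit (dB j)) S ∅)
      (atEmpty ΛB) lA = ∑ sA : (∀ i : {i // ¬ i ∈ S}, ΛA i),
        (∑ sB : (∀ j : {j // ¬ j ∈ (∅ : Finset (Fin m))}, ΛB j),
          p.trans c z (glue ∅ (atEmpty ΛB) sB) (glue S lA sA)) *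
          ∏ i : {i // ¬ i ∈ S}, p.prep i (ρ i) (sA i) := by
    intro c
    simp only [OnticMap.box_contraction, h.resp_unit, Finset.prod_const_one, mul_one,
      Finset.sum_mul]
    exact Finset.sum_comm
  simp only [h2]
  rw [Finset.sum_comm]
  simp only [← Finset.sum_mul, h1, one_mul]
  rw [← Fintype.prod_sum]
  simp [h.prep_sum]

/-! ### The operators representing states, effects and one-system processes -/

/-- For each ontic state, its weight respects linear relations among states, so it is a trace
against an operator. Nonnegativity and normalization on all states make these operators a POVM. -/
lemma exists_povm (h : IsOntologicalModel I p) (i : Fin n) :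
    ∃ G : ΛA i → Matrix (Fin (dA i)) (Fin (dA i)) ℂ,
      (∀ ρ l, (ρ.1 * G l).trace = p.prep i ρ l) ∧ (∀ l, (G l).PosSemidef) ∧ ∑ l, G l = 1 := by
  have key : ∀ l, ∃ G : Matrix (Fin (dA i)) (Fin (dA i)) ℂ, G.IsHermitian ∧
      ∀ ρ : Density (dA i), (ρ.1 * G).trace = p.prep i ρ l := by
    intro l
    obtain ⟨G, hG, hG'⟩ := exists_mem_span_trace_eq (fun ρ : Density (dA i) => ρ.1)
      (fun ρ => ρ.2.1.isHermitian) (fun ρ => p.prep i ρ l) fun k ρ α hα =>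
        h.prep_linear i k ρ α (by simpa only [ofReal_smul_matrix] using hα) l
    refine ⟨G, isHermitian_of_mem_span ?_ hG, hG'⟩
    rintro _ ⟨ρ, rfl⟩
    exact ρ.2.1.isHermitian
  choose G hG hG' using key
  refine ⟨G, fun ρ l => hG' l ρ, fun l => posSemidef_of_forall_density (hG l) fun ρ => ?_, ?_⟩
  · rw [hG']
    exact h.prep_nonneg i ρ l
  · rw [← sub_eq_zero]
    refine eq_zero_of_forall_density fun ρ => ?_
    rw [Matrix.mul_sub, Matrix.trace_sub, Matrix.mul_sum, Matrix.trace_sum, Matrix.mul_one, ρ.2.2,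
      sub_eq_zero]
    simp only [hG']
    exact_mod_cast h.prep_sum i ρ

/-- Riesz representation for response functions; unit trace is the response to the one-element POVM
{1}. -/
lemma exists_densities (h : IsOntologicalModel I p) (j : Fin m) :
    ∃ σ : ΛB j → Matrix (Fin (dB j)) (Fin (dB j)) ℂ,
      (∀ M l, (M.1 * σ l).trace = p.resp j M l) ∧
        ∀ l, (σ l).PosSemidef ∧ (σ l).trace = 1 := by
  have key : ∀ l, ∃ G : Matrix (Fin (dB j)) (Fin (dB j)) ℂ, G.IsHermitian ∧
      ∀ M : Effect (dB j), (M.1 * G).trace = p.resp j M l := by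
    intro l
    obtain ⟨G, hG, hG'⟩ := exists_mem_span_trace_eq (fun M : Effect (dB j) => M.1)
      (fun M => M.2.1.isHermitian) (fun M => p.resp j M l) fun k M α hα =>
        h.resp_linear j k M α (by simpa only [ofReal_smul_matrix] using hα) l
    refine ⟨G, isHermitian_of_mem_span ?_ hG, hG'⟩
    rintro _ ⟨M, rfl⟩
    exact M.2.1.isHermitian
  choose σ hσ hσ' using key
  refine ⟨σ, fun M l => hσ' l M, fun l => ⟨posSemidef_of_forall_effect (hσ l) fun M => ?_, ?_⟩⟩
  · rw [hσ']
    exact h.resp_nonneg j M l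
  · have h1 := hσ' l (Effect.unit _)
    rw [h.resp_unit] at h1
    simpa [Effect.unit] using h1

/-- A linear relation among slices is an operational identity among processes with a single open
output, so the box values define a functional on V. The Riesz operator is taken inside V, as the
dual reconstruction and the projection of 1 later require. -/
lemma exists_outputDual (h : IsOntologicalModel I p) (j : Fin m) :
    ∃ H : ΛB j → Matrix (Fin (dB j)) (Fin (dB j)) ℂ, (∀ l, H l ∈ I.outputSpace j) ∧
      ∀ (a : Contraction dA dB C Z) l, (outputSlice I a.1 a.2.1 j a.2.2.1 a.2.2.2 * H l).trace =
        p.box (a.box ∅ {j}) (atSingle l) (atEmpty ΛA) := by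
  rw [outputSpace_eq]
  have key := fun l => exists_mem_span_trace_eq
    (fun a : Contraction dA dB C Z => outputSlice I a.1 a.2.1 j a.2.2.1 a.2.2.2)
    (fun a => outputSlice_isHermitian ..)
    (fun a => p.box (a.box ∅ {j}) (atSingle l) (atEmpty ΛA)) fun k a α hα =>
      h.box_linear a α (fun Y X => by
        have h1 := congrArg (fun W => (Y ⟨j, Finset.mem_singleton_self j⟩ * W).trace) hα
        simp only [Matrix.mul_sum, Matrix.trace_sum, ← ofReal_smul_matrix, Matrix.mul_smul,
          Matrix.trace_smul, trace_mul_outputSlice, Matrix.mul_zero, Matrix.trace_zero,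
          smul_eq_mul] at h1
        rw [← h1]
        refine Finset.sum_congr rfl fun x _ => ?_
        rw [glue_singleton j Y fun j => ((a x).2.2.2 j).1,
          glue_empty X fun i => ((a x).2.2.1 i).1]) _ _
  choose H hH hH' using key
  exact ⟨H, hH, fun a l => hH' l a⟩

/-- The same argument for processes with a single open input. -/
lemma exists_inputFrame (h : IsOntologicalModel I p) (i : Fin n) :
    ∃ F : ΛA i → Matrix (Fin (dA i)) (Fin (dA i)) ℂ, (∀ l, F l ∈ I.inputSpace i) ∧
      ∀ (a : Contraction dA dB C Z) l, (inputSlice I a.1 a.2.1 i a.2.2.1 a.2.2.2 * F l).trace =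
        p.box (a.box {i} ∅) (atEmpty ΛB) (atSingle l) := by
  rw [inputSpace_eq]
  have key := fun l => exists_mem_span_trace_eq
    (fun a : Contraction dA dB C Z => inputSlice I a.1 a.2.1 i a.2.2.1 a.2.2.2)
    (fun a => inputSlice_isHermitian ..)
    (fun a => p.box (a.box {i} ∅) (atEmpty ΛB) (atSingle l)) fun k a α hα =>
      h.box_linear a α (fun Y X => by
        have h1 := congrArg (fun W => (X ⟨i, Finset.mem_singleton_self i⟩ * W).trace) hα
        simp only [Matrix.mul_sum, Matrix.trace_sum, ← ofReal_smul_matrix, Matrix.mul_smul,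
          Matrix.trace_smul, trace_mul_inputSlice, Matrix.mul_zero, Matrix.trace_zero,
          smul_eq_mul] at h1
        rw [← h1]
        refine Finset.sum_congr rfl fun x _ => ?_
        rw [glue_singleton i X fun i => ((a x).2.2.1 i).1,
          glue_empty Y fun j => ((a x).2.2.2 j).1]) _ _
  choose F hF hF' using key
  exact ⟨F, hF, fun a l => hF' l a⟩

/-- The box values of a one-output process expand its operator in the representing densities. -/
lemma outputSlice_eq_sum (h : IsOntologicalModel I p) (j : Fin m)
    {σ : ΛB j → Matrix (Fin (dB j)) (Fin (dB j)) ℂ}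
    (hσ : ∀ M l, (M.1 * σ l).trace = p.resp j M l) (a : Contraction dA dB C Z) :
    outputSlice I a.1 a.2.1 j a.2.2.1 a.2.2.2 =
      ∑ l, (p.box (a.box ∅ {j}) (atSingle l) (atEmpty ΛA) : ℂ) • σ l := by
  rw [← sub_eq_zero]
  refine eq_zero_of_forall_effect fun M => ?_
  rw [Matrix.mul_sub, Matrix.trace_sub, sub_eq_zero, trace_mul_outputSlice]
  have h1 := h.sum_box a ∅ {j} (atSingle (α := fun j => Effect (dB j)) M)
    (atEmpty fun i => Density (dA i))
  rw [glue_singleton j _ fun j => (a.2.2.2 j).1, glue_empty _ fun i => (a.2.2.1 i).1,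
    atSingle_self] at h1
  rw [← h1, sum_atSingle]
  push_cast
  simp only [Matrix.mul_sum, Matrix.trace_sum, Matrix.mul_smul, Matrix.trace_smul, hσ, smul_eq_mul]
  refine Finset.sum_congr rfl fun l _ => ?_
  rw [sum_atEmpty]
  rw [prod_single, prod_empty, mul_one]
  rfl

/-- Both sides give the same statistics on every state fed into input `i`, and states separate
operators. -/
lemma inputSlice_eq_sum (h : IsOntologicalModel I p) (i : Fin n)
    {G : ΛA i → Matrix (Fin (dA i)) (Fin (dA i)) ℂ}
    (hG : ∀ ρ l, (ρ.1 * G l).trace = p.prep i ρ l) (a : Contraction dA dB C Z) :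
    inputSlice I a.1 a.2.1 i a.2.2.1 a.2.2.2 =
      ∑ l, (p.box (a.box {i} ∅) (atEmpty ΛB) (atSingle l) : ℂ) • G l := by
  rw [← sub_eq_zero]
  refine eq_zero_of_forall_density fun ρ => ?_
  rw [Matrix.mul_sub, Matrix.trace_sub, sub_eq_zero, trace_mul_inputSlice]
  have h1 := h.sum_box a {i} ∅ (atEmpty fun j => Effect (dB j))
    (atSingle (α := fun i => Density (dA i)) ρ)
  rw [glue_singleton i _ fun i => (a.2.2.1 i).1, glue_empty _ fun j => (a.2.2.2 j).1,
    atSingle_self] at h1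
  rw [← h1, sum_atEmpty, sum_atSingle]
  push_cast
  simp only [Matrix.mul_sum, Matrix.trace_sum, Matrix.mul_smul, Matrix.trace_smul, hG, smul_eq_mul]
  refine Finset.sum_congr rfl fun l _ => ?_
  rw [prod_single, prod_empty, mul_one]
  rfl

/-- This is trace preservation seen from one input. It puts 1 in V_{A_i} and fixes the traces of the
frame `F`. -/
lemma sum_inputSlice (z : Z) (i : Fin n) (ρ : ∀ i, Density (dA i)) :
    ∑ c, inputSlice I c z i ρ (fun j => Effect.unit (dB j)) = 1 := by
  rw [← sub_eq_zero]
  refine eq_zero_of_forall_density fun τ => ?_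
  rw [Matrix.mul_sub, Matrix.trace_sub, Matrix.mul_one, τ.2.2, Matrix.mul_sum, Matrix.trace_sum,
    sub_eq_zero]
  simp only [trace_mul_inputSlice, pairing, Effect.coe_unit, tensor_one, Matrix.one_mul]
  rw [← Matrix.trace_sum, I.tracePreserving, trace_tensor]
  refine Finset.prod_eq_one fun k _ => ?_
  by_cases hk : k = i
  · subst hk; simpa using τ.2.2
  · simpa [hk] using (ρ k).2.2

end IsOntologicalModel

end ModelToFrame

/-- The product over the slots of the pairings with fixed operators, as a real multilinear map. -/
noncomputable def slotForm {ι : Type*} [Fintype ι] {d : ι → ℕ}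
    (N : ∀ i, Matrix (Fin (d i)) (Fin (d i)) ℂ) :
    MultilinearMap ℝ (fun i => Matrix (Fin (d i)) (Fin (d i)) ℂ) ℂ :=
  (MultilinearMap.mkPiAlgebra ℝ ι ℂ).compLinearMap fun i =>
    (Matrix.traceLinearMap _ ℝ ℂ ∘ₗ LinearMap.mulRight ℝ (N i))

lemma slotForm_apply {ι : Type*} [Fintype ι] {d : ι → ℕ}
    (N v : ∀ i, Matrix (Fin (d i)) (Fin (d i)) ℂ) :
    slotForm N v = ∏ i, (v i * N i).trace := by
  simp [slotForm]

/-! ### Parallel compositions of one-system processes -/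

section ModelToFrame

variable {n m : ℕ} {dA : Fin n → ℕ} {dB : Fin m → ℕ} {C Z : Type*} [Fintype C]

/-- The parallel composition of one-system processes, one for every output and every input. -/
def productComposite (aB : Fin m → Contraction dA dB C Z) (aA : Fin n → Contraction dA dB C Z) :
    Composite dA dB C Z Finset.univ Finset.univ where
  k := m + n
  box := Fin.addCases (fun j => (aB j).box ∅ {j}) fun i => (aA i).box {i} ∅
  inputs_disjoint μ ν h := by
    induction μ using Fin.addCases <;> induction ν using Fin.addCases <;>
      simp_all [Contraction.box]
  outputs_disjoint μ ν h := by
    induction μ using Fin.addCases <;> induction ν using Fin.addCases <;>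
      simp_all [Contraction.box]
  inputs_union i := by
    simp only [Finset.mem_univ, true_iff]
    exact ⟨Fin.natAdd m i, by simp [Contraction.box]⟩
  outputs_union j := by
    simp only [Finset.mem_univ, true_iff]
    exact ⟨Fin.castAdd n j, by simp [Contraction.box]⟩

variable (I : MultiInstrument dA dB C Z)

lemma pairing_productComposite (aB : Fin m → Contraction dA dB C Z)
    (aA : Fin n → Contraction dA dB C Z) (Y : ∀ j, Matrix (Fin (dB j)) (Fin (dB j)) ℂ)
    (X : ∀ i, Matrix (Fin (dA i)) (Fin (dA i)) ℂ) :
    pairing (d := fun i : {i // i ∈ (Finset.univ : Finset (Fin n))} => dA i)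
        (d' := fun j : {j // j ∈ (Finset.univ : Finset (Fin m))} => dB j)
        ((productComposite aB aA).process I) (fun j => Y j) (fun i => X i) =
      slotForm Y (fun j => outputSlice I (aB j).1 (aB j).2.1 j (aB j).2.2.1 (aB j).2.2.2) *
        slotForm X (fun i => inputSlice I (aA i).1 (aA i).2.1 i (aA i).2.2.1 (aA i).2.2.2) := by
  rw [pairing_composite, slotForm_apply, slotForm_apply]
  -- Each factor depends on ν only through its box; naming this function lets the product over `m +
  -- n` boxes split into its output and input parts.
  let Ψ : Box dA dB C Z → ℂ := fun b => pairing (I.map b.c b.z)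
    (glue b.outputs (fun j => Y j) fun j => (b.effect j).1)
    (glue b.inputs (fun i => X i) fun i => (b.state i).1)
  change ∏ ν : Fin (m + n), Ψ (Fin.addCases (fun j => (aB j).box ∅ {j})
    (fun i => (aA i).box {i} ∅) ν) = _
  rw [Fin.prod_univ_add]
  simp only [Fin.addCases_left, Fin.addCases_right]
  congr 1
  · refine Finset.prod_congr rfl fun j _ => ?_
    rw [Matrix.trace_mul_comm, trace_mul_outputSlice]
    simp only [Ψ, Contraction.box]
    rw [glue_singleton j _ fun k => ((aB j).2.2.2 k).1, glue_empty _ fun k => ((aB j).2.2.1 k).1]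
  · refine Finset.prod_congr rfl fun i _ => ?_
    rw [Matrix.trace_mul_comm, trace_mul_inputSlice]
    simp only [Ψ, Contraction.box]
    rw [glue_singleton i _ fun k => ((aA i).2.2.1 k).1, glue_empty _ fun k => ((aA i).2.2.2 k).1]

variable {I} {ΛA : Fin n → Type} {ΛB : Fin m → Type} [∀ i, Fintype (ΛA i)] [∀ j, Fintype (ΛB j)]
  {p : OnticMap dA dB C Z ΛA ΛB}

omit [Fintype C] in
lemma OnticMap.composite_product (aB : Fin m → Contraction dA dB C Z)
    (aA : Fin n → Contraction dA dB C Z) (lB : ∀ j, ΛB j) (lA : ∀ i, ΛA i) :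
    p.composite (productComposite aB aA) (fun j => lB j) (fun i => lA i) =
      (∏ j, p.box ((aB j).box ∅ {j}) (atSingle (lB j)) (atEmpty ΛA)) *
        ∏ i, p.box ((aA i).box {i} ∅) (atEmpty ΛB) (atSingle (lA i)) := by
  let Ψ : Box dA dB C Z → ℝ := fun b => p.box b (fun j => lB j) fun i => lA i
  change ∏ ν : Fin (m + n), Ψ (Fin.addCases (fun j => (aB j).box ∅ {j})
    (fun i => (aA i).box {i} ∅) ν) = _
  rw [Fin.prod_univ_add]
  simp only [Fin.addCases_left, Fin.addCases_right]
  congr 1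
  · refine Finset.prod_congr rfl fun j _ => ?_
    exact congrArg₂ (p.box ((aB j).box ∅ {j})) (eq_atSingle (α := ΛB) (fun k => lB k))
      (eq_atEmpty (α := ΛA) _)
  · refine Finset.prod_congr rfl fun i _ => ?_
    exact congrArg₂ (p.box ((aA i).box {i} ∅)) (eq_atEmpty (α := ΛB) _)
      (eq_atSingle (α := ΛA) (fun k => lA k))

/-- The real span of the pairs of a composite with all systems open and of its representation. -/
noncomputable def compositeGraph (I : MultiInstrument dA dB C Z) (p : OnticMap dA dB C Z ΛA ΛB)
    (lB : ∀ j, ΛB j) (lA : ∀ i, ΛA i) :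
    Submodule ℝ (((∀ j, Matrix (Fin (dB j)) (Fin (dB j)) ℂ) →
      (∀ i, Matrix (Fin (dA i)) (Fin (dA i)) ℂ) → ℂ) × ℂ) :=
  Submodule.span ℝ (Set.range fun D : Composite dA dB C Z Finset.univ Finset.univ =>
    ((fun Y X => pairing (d := fun i : {i // i ∈ (Finset.univ : Finset (Fin n))} => dA i)
        (d' := fun j : {j // j ∈ (Finset.univ : Finset (Fin m))} => dB j)
        (D.process I) (fun j => Y j) fun i => X i),
      (p.composite D (fun j => lB j) (fun i => lA i) : ℂ)))

namespace IsOntologicalModel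

/-- Preservation of operational identities says exactly that this span is the graph of a
single-valued map. -/
lemma eq_zero_of_mem_compositeGraph (h : IsOntologicalModel I p) {lB : ∀ j, ΛB j}
    {lA : ∀ i, ΛA i} {r : ℂ} (hr : (0, r) ∈ compositeGraph I p lB lA) : r = 0 := by
  obtain ⟨k, α, g, hg⟩ := Submodule.mem_span_set'.1 hr
  choose D hD using fun x => (g x).2
  simp only [← hD] at hg
  have h1 := congrArg Prod.fst hg
  have h2 := congrArg Prod.snd hg
  simp only [Prod.fst_sum, Prod.snd_sum, Prod.smul_mk] at h1 h2
  have h3 := h.composite_linear_of_pairing D α (fun Y X => by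
    have h4 := congrFun (congrFun h1 fun j => Y ⟨j, Finset.mem_univ j⟩)
      fun i => X ⟨i, Finset.mem_univ i⟩
    simpa [Finset.sum_apply] using h4) (fun j => lB j) (fun i => lA i)
  rw [← h2]
  simp only [Complex.real_smul]
  exact_mod_cast h3

/-- When all `v j` and `w i` are slices, this pair comes from a `productComposite`. Real
multilinearity extends it to their spans, with the representation still evaluated by traces against
`H` and `F`. -/
lemma slotForm_mem_compositeGraph {H : ∀ j, ΛB j → Matrix (Fin (dB j)) (Fin (dB j)) ℂ}
    {F : ∀ i, ΛA i → Matrix (Fin (dA i)) (Fin (dA i)) ℂ}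
    (hH : ∀ j (a : Contraction dA dB C Z) l,
      (outputSlice I a.1 a.2.1 j a.2.2.1 a.2.2.2 * H j l).trace =
        p.box (a.box ∅ {j}) (atSingle l) (atEmpty ΛA))
    (hF : ∀ i (a : Contraction dA dB C Z) l,
      (inputSlice I a.1 a.2.1 i a.2.2.1 a.2.2.2 * F i l).trace =
        p.box (a.box {i} ∅) (atEmpty ΛB) (atSingle l))
    (lB : ∀ j, ΛB j) (lA : ∀ i, ΛA i)
    {v : ∀ j, Matrix (Fin (dB j)) (Fin (dB j)) ℂ} (hv : ∀ j, v j ∈ I.outputSpace j)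
    {w : ∀ i, Matrix (Fin (dA i)) (Fin (dA i)) ℂ} (hw : ∀ i, w i ∈ I.inputSpace i) :
    ((fun Y X => slotForm Y v * slotForm X w),
      slotForm (fun j => H j (lB j)) v * slotForm (fun i => F i (lA i)) w) ∈
      compositeGraph I p lB lA := by
  simp only [outputSpace_eq] at hv
  simp only [inputSpace_eq] at hw
  let fB : MultilinearMap ℝ (fun j => Matrix (Fin (dB j)) (Fin (dB j)) ℂ)
      (((∀ j, Matrix (Fin (dB j)) (Fin (dB j)) ℂ) →
        (∀ i, Matrix (Fin (dA i)) (Fin (dA i)) ℂ) → ℂ) × ℂ) :=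
    (MultilinearMap.pi fun Y => MultilinearMap.pi fun X => slotForm X w • slotForm Y).prod
      (slotForm (fun i => F i (lA i)) w • slotForm fun j => H j (lB j))
  have hfB : ∀ v, fB v = ((fun Y X => slotForm Y v * slotForm X w),
      slotForm (fun j => H j (lB j)) v * slotForm (fun i => F i (lA i)) w) := by
    intro v
    refine Prod.ext ?_ (mul_comm _ _)
    funext Y X
    exact mul_comm _ _
  rw [← hfB]
  refine multilinear_mem_of_mem_span fB _ _ (fun v hv => ?_) v hv
  choose aB haB using hv
  obtain rfl := funext haB
  rw [hfB]
  -- The output operators are now slices and stay fixed while the inputs are extended in the same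
  -- way.
  clear hfB fB
  set v := fun j => outputSlice I (aB j).1 (aB j).2.1 j (aB j).2.2.1 (aB j).2.2.2
  let fA : MultilinearMap ℝ (fun i => Matrix (Fin (dA i)) (Fin (dA i)) ℂ)
      (((∀ j, Matrix (Fin (dB j)) (Fin (dB j)) ℂ) →
        (∀ i, Matrix (Fin (dA i)) (Fin (dA i)) ℂ) → ℂ) × ℂ) :=
    (MultilinearMap.pi fun Y => MultilinearMap.pi fun X => slotForm Y v • slotForm X).prod
      (slotForm (fun j => H j (lB j)) v • slotForm fun i => F i (lA i))
  change fA w ∈ _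
  refine multilinear_mem_of_mem_span fA _ _ (fun w hw => ?_) w hw
  choose aA haA using hw
  obtain rfl := funext haA
  refine Submodule.subset_span ⟨productComposite aB aA, ?_⟩
  refine Prod.ext ?_ ?_
  · funext Y X
    exact pairing_productComposite I aB aA Y X
  · change ((p.composite (productComposite aB aA) (fun j => lB j) (fun i => lA i) : ℝ) : ℂ) =
      slotForm (fun j => H j (lB j)) v * slotForm (fun i => F i (lA i)) _
    rw [OnticMap.composite_product, slotForm_apply, slotForm_apply]
    push_cast
    simp only [v, hH, hF]

end IsOntologicalModel

end ModelToFrame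

/-! ### Frame decomposition of the instrument -/

section Decomposition

variable {n m : ℕ} {dA : Fin n → ℕ} {dB : Fin m → ℕ} {C Z : Type*} [Fintype C]
  {I : MultiInstrument dA dB C Z} {kA : Fin n → ℕ} {kB : Fin m → ℕ}
  {E D : ∀ j, Fin (kB j) → Matrix (Fin (dB j)) (Fin (dB j)) ℂ}
  {F G : ∀ i, Fin (kA i) → Matrix (Fin (dA i)) (Fin (dA i)) ℂ}

/-- Expansion of the contractions of an instrument in frames of the output and input spaces. -/
lemma pairing_eq_sum_of_frames (hA : ∀ i, 0 < dA i)
    (hB' : ∀ j, IsFrameWithDual (I.outputSpace j) (E j) (D j))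
    (hA' : ∀ i, IsFrameWithDual (I.inputSpace i) (G i) (F i)) (c : C) (z : Z)
    (Y : ∀ j, Matrix (Fin (dB j)) (Fin (dB j)) ℂ) (X : ∀ i, Matrix (Fin (dA i)) (Fin (dA i)) ℂ) :
    pairing (I.map c z) Y X = ∑ lB : (∀ j, Fin (kB j)), ∑ lA : (∀ i, Fin (kA i)),
      pairing (I.map c z) (fun j => D j (lB j)) (fun i => F i (lA i)) *
        (∏ j, (Y j * E j (lB j)).trace) * ∏ i, (X i * G i (lA i)).trace := by
  rw [pairing_congr_output I c z (Y' := fun j => ∑ l, (Y j * E j l).trace • D j l)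
      _ fun j W hW => (hB' j).trace_mul_sub _ hW,
    pairing_congr_input I hA c z (X' := fun i => ∑ l, (X i * G i l).trace • F i l)
      _ fun i W hW => (hA' i).trace_mul_sub _ hW,
    ← pairingOut_apply, multilinear_sum_smul]
  refine Finset.sum_congr rfl fun lB _ => ?_
  rw [pairingOut_apply, ← pairingIn_apply, multilinear_sum_smul, Finset.mul_sum]
  refine Finset.sum_congr rfl fun lA _ => ?_
  rw [pairingIn_apply]
  ring

lemma map_eq_sum_of_frames (hA : ∀ i, 0 < dA i)
    (hB' : ∀ j, IsFrameWithDual (I.outputSpace j) (E j) (D j))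
    (hA' : ∀ i, IsFrameWithDual (I.inputSpace i) (G i) (F i)) (c : C) (z : Z) (X : Op dA) :
    I.map c z X = ∑ lA : (∀ i, Fin (kA i)), ∑ lB : (∀ j, Fin (kB j)),
      ((tensor dB (fun j => D j (lB j)) * I.map c z (tensor dA fun i => F i (lA i))).trace *
        (tensor dA (fun i => G i (lA i)) * X).trace) • tensor dB fun j => E j (lB j) := by
  -- The decomposition is packaged as a linear map, so that comparing pairings on product operators
  -- suffices.
  let Ψ : Op dA →ₗ[ℂ] Op dB := ∑ lA : (∀ i, Fin (kA i)), ∑ lB : (∀ j, Fin (kB j)),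
    pairing (I.map c z) (fun j => D j (lB j)) (fun i => F i (lA i)) •
      (Matrix.traceLinearMap _ ℂ ℂ ∘ₗ
        LinearMap.mulLeft ℂ (tensor dA fun i => G i (lA i))).smulRight
          (tensor dB fun j => E j (lB j))
  have hΨ : ∀ X, Ψ X = ∑ lA : (∀ i, Fin (kA i)), ∑ lB : (∀ j, Fin (kB j)),
      ((tensor dB (fun j => D j (lB j)) * I.map c z (tensor dA fun i => F i (lA i))).trace *
        (tensor dA (fun i => G i (lA i)) * X).trace) • tensor dB fun j => E j (lB j) := by
    intro X
    simp [Ψ, pairing, smul_smul]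
  rw [← hΨ]
  congr 1
  refine eq_of_pairing_eq fun Y X => ?_
  rw [pairing_eq_sum_of_frames hA hB' hA', Finset.sum_comm]
  rw [pairing, hΨ]
  simp only [Matrix.mul_sum, Matrix.trace_sum, Matrix.mul_smul, Matrix.trace_smul, tensor_mul,
    trace_tensor, smul_eq_mul]
  refine Finset.sum_congr rfl fun lA _ => Finset.sum_congr rfl fun lB _ => ?_
  rw [pairing]
  simp only [Matrix.trace_mul_comm (G _ _)]
  ring

end Decomposition

/-! ### Transition probabilities as frame coefficients, and the equivalence -/

section Main

variable {n m : ℕ} {dA : Fin n → ℕ} {dB : Fin m → ℕ} {C Z : Type*} [Fintype C]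
  {I : MultiInstrument dA dB C Z} {kA : Fin n → ℕ} {kB : Fin m → ℕ}
  {p : OnticMap dA dB C Z (fun i => Fin (kA i)) (fun j => Fin (kB j))}

/-- The conditional probabilities of a model are the coefficients in the frame representation. -/
lemma IsOntologicalModel.ofReal_trans (h : IsOntologicalModel I p) (hA : ∀ i, 0 < dA i)
    {σ H : ∀ j, Fin (kB j) → Matrix (Fin (dB j)) (Fin (dB j)) ℂ}
    {F G : ∀ i, Fin (kA i) → Matrix (Fin (dA i)) (Fin (dA i)) ℂ}
    (hσ : ∀ j l, (σ j l).PosSemidef) (hG : ∀ i l, (G i l).PosSemidef)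
    (hHV : ∀ j l, H j l ∈ I.outputSpace j) (hFV : ∀ i l, F i l ∈ I.inputSpace i)
    (hH : ∀ j (a : Contraction dA dB C Z) l,
      (outputSlice I a.1 a.2.1 j a.2.2.1 a.2.2.2 * H j l).trace =
        p.box (a.box ∅ {j}) (atSingle (α := fun j => Fin (kB j)) l)
          (atEmpty fun i => Fin (kA i)))
    (hF : ∀ i (a : Contraction dA dB C Z) l,
      (inputSlice I a.1 a.2.1 i a.2.2.1 a.2.2.2 * F i l).trace =
        p.box (a.box {i} ∅) (atEmpty fun j => Fin (kB j))
          (atSingle (α := fun i => Fin (kA i)) l))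
    (hB' : ∀ j, IsFrameWithDual (I.outputSpace j) (σ j) (H j))
    (hA' : ∀ i, IsFrameWithDual (I.inputSpace i) (G i) (F i))
    (c : C) (z : Z) (lB : ∀ j, Fin (kB j)) (lA : ∀ i, Fin (kA i)) :
    (p.trans c z lB lA : ℂ) =
      pairing (I.map c z) (fun j => H j (lB j)) fun i => F i (lA i) := by
  -- Frames and duals are interchanged: the expansion operators must be `H` and `F`, which lie in
  -- the spaces V, while the coefficients are pairings with the positive `σ` and `G` and hence real.
  have hexp := pairing_eq_sum_of_frames hA (fun j => (hB' j).symm) (fun i => (hA' i).symm) c z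
  -- First value over F_{c|z} in the graph: as a real combination of products of one-system
  -- operators, it is represented by the pairing with `H` and `F`.
  have hmem : ((fun Y X => pairing (I.map c z) Y X),
      pairing (I.map c z) (fun j => H j (lB j)) fun i => F i (lA i)) ∈
      compositeGraph I p lB lA := by
    have h1 : ∑ lB' : (∀ j, Fin (kB j)), ∑ lA' : (∀ i, Fin (kA i)),
        (pairing (I.map c z) (fun j => σ j (lB' j)) fun i => G i (lA' i)).re •
        (((fun Y X => slotForm Y (fun j => H j (lB' j)) * slotForm X (fun i => F i (lA' i))),
          slotForm (fun j => H j (lB j)) (fun j => H j (lB' j)) *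
            slotForm (fun i => F i (lA i)) (fun i => F i (lA' i))) :
          ((∀ j, Matrix (Fin (dB j)) (Fin (dB j)) ℂ) →
            (∀ i, Matrix (Fin (dA i)) (Fin (dA i)) ℂ) → ℂ) × ℂ) ∈ compositeGraph I p lB lA :=
      Submodule.sum_mem _ fun lB' _ => Submodule.sum_mem _ fun lA' _ =>
        Submodule.smul_mem _ _ (IsOntologicalModel.slotForm_mem_compositeGraph hH hF lB lA
          (fun j => hHV j _) fun i => hFV i _)
    have hre : ∀ (lB' : ∀ j, Fin (kB j)) (lA' : ∀ i, Fin (kA i)),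
        ((pairing (I.map c z) (fun j => σ j (lB' j)) fun i => G i (lA' i)).re : ℂ) =
          pairing (I.map c z) (fun j => σ j (lB' j)) fun i => G i (lA' i) := fun lB' lA' =>
      Complex.conj_eq_iff_re.1 (Complex.conj_eq_iff_im.2 (Complex.nonneg_iff.1
        (pairing_nonneg I c z (fun j => hσ j _) fun i => hG i _)).2.symm)
    have hval : ∀ Y X, pairing (I.map c z) Y X =
        ∑ lB' : (∀ j, Fin (kB j)), ∑ lA' : (∀ i, Fin (kA i)),
        (pairing (I.map c z) (fun j => σ j (lB' j)) fun i => G i (lA' i)).re •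
          (slotForm Y (fun j => H j (lB' j)) * slotForm X (fun i => F i (lA' i))) := by
      intro Y X
      rw [hexp]
      refine Finset.sum_congr rfl fun lB' _ => Finset.sum_congr rfl fun lA' _ => ?_
      rw [Complex.real_smul, hre, slotForm_apply, slotForm_apply, mul_assoc]
      simp only [Matrix.trace_mul_comm (H _ _), Matrix.trace_mul_comm (F _ _)]
    convert h1 using 1
    refine Prod.ext ?_ ?_
    · funext Y X
      refine (hval Y X).trans ?_
      simp [Prod.fst_sum, Finset.sum_apply]
    · refine (hval _ _).trans ?_
      simp [Prod.snd_sum]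
  -- Second value over the same process: F_{c|z} as a single box with everything open. The chosen
  -- states and effects are fillers, and single-valuedness of the graph equates the two values.
  have hmem' : ((fun Y X => pairing (I.map c z) Y X), (p.trans c z lB lA : ℂ)) ∈
      compositeGraph I p lB lA := by
    have ρ : ∀ i, Density (dA i) := fun i => (nonempty_density (hA i)).some
    let a : Contraction dA dB C Z := (c, z, ρ, fun j => Effect.unit _)
    refine Submodule.subset_span ⟨a.composite Finset.univ Finset.univ, ?_⟩
    refine Prod.ext ?_ ?_
    · funext Y X
      change pairing _ _ _ = pairing _ _ _
      rw [pairing_contraction_composite, glue_univ Y, glue_univ X]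
    · change ((p.composite _ _ _ : ℝ) : ℂ) = _
      rw [OnticMap.composite_contraction, OnticMap.box_contraction]
      simp only [glue_univ lB, glue_univ lA]
      have h1 : IsEmpty {j : Fin m // ¬ j ∈ (Finset.univ : Finset (Fin m))} :=
        ⟨fun j => j.2 (Finset.mem_univ _)⟩
      have h2 : IsEmpty {i : Fin n // ¬ i ∈ (Finset.univ : Finset (Fin n))} :=
        ⟨fun i => i.2 (Finset.mem_univ _)⟩
      simp [a]
  have := Submodule.sub_mem _ hmem' hmem
  rw [Prod.mk_sub_mk, sub_self] at this
  exact sub_eq_zero.1 (h.eq_zero_of_mem_compositeGraph this)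

theorem IsOntologicalModel.admitsFrameRepresentation [Nonempty Z] (h : IsOntologicalModel I p)
    (hA : ∀ i, 0 < dA i) : I.AdmitsFrameRepresentation := by
  choose G hG hGpos hGsum using h.exists_povm
  choose σ hσ hσd using h.exists_densities
  choose H hHV hH using h.exists_outputDual
  choose F hFV hF using h.exists_inputFrame
  have hB' : ∀ j, IsFrameWithDual (I.outputSpace j) (σ j) (H j) := fun j =>
    isFrameWithDual_of_reconstruct (fun X hX => isHermitian_of_mem_outputSpace I hX)
      (fun l => (hσd j l).1.isHermitian) (hHV j) (by
        rw [outputSpace_eq]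
        refine reconstruct_of_span _ fun a => ?_
        simp only [hH]
        exact h.outputSlice_eq_sum j (hσ j) a)
  have hA' : ∀ i, IsFrameWithDual (I.inputSpace i) (G i) (F i) := fun i =>
    isFrameWithDual_of_reconstruct (fun X hX => isHermitian_of_mem_inputSpace I hX)
      (fun l => (hGpos i l).isHermitian) (hFV i) (by
        rw [inputSpace_eq]
        refine reconstruct_of_span _ fun a => ?_
        simp only [hF]
        exact h.inputSlice_eq_sum i (hG i) a)
  obtain ⟨z⟩ := ‹Nonempty Z›
  have ρ : ∀ i, Density (dA i) := fun i => (nonempty_density (hA i)).some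
  have hone : ∀ i, ∑ c, inputSlice I c z i ρ (fun j => Effect.unit (dB j)) = 1 :=
    fun i => IsOntologicalModel.sum_inputSlice z i ρ
  refine ⟨kA, kB, σ, H, F, G, hB', hσd, fun j => ⟨Submodule.sum_mem _ fun l _ => hHV j l,
    fun W hW => ?_⟩, fun i => (hA' i).symm, fun i l => ?_, hGpos, fun i => ⟨?_, hGsum i⟩,
    fun c z lA lB => ?_, map_eq_sum_of_frames hA hB' hA'⟩
  -- Taking the trace of the reconstruction, with every Tr[σ_λ] = 1, gives Tr[W] = ∑ Tr[W H_λ].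
  · have h1 := congrArg Matrix.trace ((hB' j).reconstruct W hW)
    rw [Matrix.trace_sum] at h1
    rw [Matrix.mul_sub, Matrix.trace_sub, Matrix.mul_one, h1, Matrix.mul_sum, Matrix.trace_sum]
    simp [Matrix.trace_smul, (hσd j _).2]
  -- Writing 1 as a sum of slices turns Tr[F_λ] into the representation of discarding all outputs
  -- and the outcome, which is 1.
  · have h1 := congrArg (fun X => (X * F i l).trace) (hone i)
    simp only [Finset.sum_mul, Matrix.trace_sum, Matrix.one_mul] at h1
    rw [← h1, Finset.sum_congr rfl fun c _ =>
      hF i (c, z, ρ, fun j => Effect.unit (dB j)) l]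
    exact_mod_cast h.sum_box_discard z ρ {i} (atSingle (α := fun i => Fin (kA i)) l)
  · rw [hGsum]
    refine ⟨?_, fun W _ => by simp⟩
    rw [← hone i]
    exact Submodule.sum_mem _ fun c _ => inputSlice_mem I c z i ρ _
  -- The frame coefficient is a transition probability of the model, hence nonnegative.
  · have h1 := h.ofReal_trans hA (fun j l => (hσd j l).1) hGpos hHV hFV hH hF hB' hA' c z lB lA
    rw [pairing] at h1
    rw [← h1]
    exact_mod_cast h.trans_nonneg c z lB lA

end Main

end QProc

theorem theorem6 {n m : ℕ} (dA : Fin n → ℕ) (dB : Fin m → ℕ)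
    (hA : ∀ i, 0 < dA i) (hB : ∀ j, 0 < dB j)
    {C Z : Type*} [Fintype C] [Nonempty Z]
    (I : QProc.MultiInstrument dA dB C Z) :
    I.IsClassical ↔ I.AdmitsFrameRepresentation := by
  constructor
  · rintro ⟨kA, kB, p, h⟩
    exact h.admitsFrameRepresentation hA
  · rintro ⟨kA, kB, σ, H, F, G, h⟩
    exact ⟨kA, kB, _, h.isOntologicalModel hA⟩
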